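/- Conventions. Banach spaces are real and of dimension at least $1$; for a compact Hausdorff space $K$ and a Banach space $E$, $\mathcal C(K,E)$ is the space of continuous functions $K\to E$ with the supremum norm, and $\mathcal C(K)=\mathcal C(K,\mathbb R)$. For a closed linear subspace $\mathcal H\subseteq\mathcal C(K,E)$ let $\mathcal A\subseteq\mathcal C(K)$ be the closed linear span of the functions $x\mapsto\langle e^*,h(x)\rangle$ with $e^*\in E^*$, $h\in\mathcal H$. The Choquet boundary $\operatorname{Ch}_{\mathcal H}K$ is the set of all $x\in K$ for which the functional $f\mapsto f(x)$ on $\mathcal A$ is an extreme point of the closed unit ball of $\mathcal A^*$. A point $x\in K$ is a weak peak point (with respect to $\mathcal H$) if for every neighbourhood $U$ of $x$ and every $\varepsilon\in(0,1)$ there is $h\in\mathcal A$ such that the function $y\mapsto h(y)e$ belongs to $\mathcal H$ for every $e\in E$, and $0\le h\le 1$ on $K$, $h(x)>1-\varepsilon$, and $h<\varepsilon$ on $\operatorname{Ch}_{\mathcal H}K\setminus U$. A Banach space contains an isomorphic copy of $Y$ if it has a linear subspace linearly homeomorphic to $Y$; $c_0$ is the space of real null sequences with the supremum norm. Theorem.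 For $i=1,2$, let $K_i$ be a compact Hausdorff space, let $E_i$ be a Banach space not containing an isomorphic copy of $c_0$, and let $\mathcal H_i$ be a closed linear subspace of $\mathcal C(K_i,E_i)$ such that $\operatorname{Ch}_{\mathcal H_i}K_i$ is closed in $K_i$ and countable (possibly finite), and consists of weak peak points with respect to $\mathcal H_i$. Suppose that for all natural numbers $1\le m<n$, $E_1^m$ does not contain an isomorphic copy of $E_2^n$, and $E_2^m$ does not contain an isomorphic copy of $E_1^n$. If there exists a surjective linear isomorphism (linear homeomorphism) $T\colon\mathcal H_1\to\mathcal H_2$ with $\|T\|\,\|T^{-1}\|<3$, then $\operatorname{Ch}_{\mathcal H_1}K_1$ is homeomorphic to $\operatorname{Ch}_{\mathcal H_2}K_2$ (in the subspace topologies). -/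

import Mathlib

open Topology
open scoped ZeroAtInfty

noncomputable section

/-- The Banach space `X` contains an isomorphic copy of `Y`: some linear subspace of `X`
is linearly homeomorphic to `Y`. -/
def ContainsIsomorphicCopy (X Y : Type*) [NormedAddCommGroup X] [NormedSpace ℝ X]
    [NormedAddCommGroup Y] [NormedSpace ℝ Y] : Prop :=
  ∃ Z : Submodule ℝ X, Nonempty (Y ≃L[ℝ] Z)

/-- `E` contains an isomorphic copy of `c₀`, the space of real null sequences with the
supremum norm. -/
def ContainsCZero (E : Type*) [NormedAddCommGroup E] [NormedSpace ℝ E] : Prop :=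
  ContainsIsomorphicCopy E C₀(ℕ, ℝ)

section FunctionSpaces

variable {K E : Type*} [TopologicalSpace K] [CompactSpace K]
  [NormedAddCommGroup E] [NormedSpace ℝ E]

/-- The scalar function `x ↦ ⟨φ, h x⟩` for `φ ∈ E*` and `h ∈ C(K, E)`. -/
def dualComp (φ : StrongDual ℝ E) (h : C(K, E)) : C(K, ℝ) :=
  ⟨fun x => φ (h x), φ.continuous.comp h.continuous⟩

/-- The function `f ⊗ e`, that is `x ↦ f x • e`. -/
def tensorVec (f : C(K, ℝ)) (e : E) : C(K, E) :=
  ⟨fun x => f x • e, f.continuous.smul continuous_const⟩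

/-- The canonical scalar function space `A` of `H`: the closed linear span in `C(K, ℝ)` of all
functions `φ ∘ h` with `φ ∈ E*` and `h ∈ H`. -/
def scalarSpace (H : Submodule ℝ C(K, E)) : Submodule ℝ C(K, ℝ) :=
  (Submodule.span ℝ
    {f : C(K, ℝ) | ∃ φ : StrongDual ℝ E, ∃ h ∈ H, f = dualComp φ h}).topologicalClosure

/-- The evaluation functional `f ↦ f x` on a subspace `A` of `C(K, ℝ)`. -/
def evalFunctional (A : Submodule ℝ C(K, ℝ)) (x : K) : StrongDual ℝ A :=
  (ContinuousMap.evalCLM ℝ x : C(K, ℝ) →L[ℝ] ℝ).comp A.subtypeL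

/-- The closed unit ball of the dual `A*` of a subspace `A` of `C(K, ℝ)` in the dual norm: the
continuous linear functionals `φ` on `A` with `|φ f| ≤ ‖f‖` for all `f ∈ A`. -/
def dualUnitBall (A : Submodule ℝ C(K, ℝ)) : Set (StrongDual ℝ A) :=
  {φ | ∀ f : A, |φ f| ≤ ‖(f : C(K, ℝ))‖}

/-- The Choquet boundary of `H`: the points `x` whose evaluation functional on the scalar
function space `A` of `H` is an extreme point of the closed unit ball of `A*`. -/
def choquetBoundary (H : Submodule ℝ C(K, E)) : Set K :=
  {x | evalFunctional (scalarSpace H) x ∈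
    Set.extremePoints ℝ (dualUnitBall (scalarSpace H))}

/-- The point `x` is a weak peak point with respect to `H`. The functions `h` range over those
elements of the scalar function space with `h ⊗ e ∈ H` for every `e ∈ E`. -/
def IsWeakPeakPoint (H : Submodule ℝ C(K, E)) (x : K) : Prop :=
  ∀ U ∈ 𝓝 x, ∀ ε : ℝ, 0 < ε → ε < 1 →
    ∃ h ∈ scalarSpace H, (∀ e : E, tensorVec h e ∈ H) ∧
      (∀ y, 0 ≤ h y ∧ h y ≤ 1) ∧ 1 - ε < h x ∧ ∀ y ∈ choquetBoundary H \ U, h y < ε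

end FunctionSpaces

end

/-! Scalar functions in `scalarSpace` attain their norm on the Choquet boundary (Krein–Milman and
Milman), so restriction to it is isometric. When the boundary is closed, countable and made of weak
peak points, restriction is also onto (`restrictChoquet_surjective`). Thus `T` becomes an
isomorphism from C(K, E) onto C(L, F) with K and L countable and compact.

After scaling, ‖f‖ ≤ ‖S f‖ ≤ c‖f‖ with c < 3. The core is `exists_mem_iteratedDerivedSet_le_norm`:
if ‖f‖ ≤ ‖e‖ and f = e near a point of the derived set K^(α), then ‖S f‖ ≥ (3 - c)/3 · ‖e‖ somewhere
on L^(α). Otherwise the absence of c₀ in F yields a nonempty clopen W, inside the set where f = e,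
such that at each y with S f y large some clopen V ⊇ W has S(1_V e) y small. Then f + 2·1_W e has
norm at least 3‖e‖, whereas changing the sign of f on W or on V \ W keeps its norm below ‖e‖ and
bounds the image by less than 3‖e‖.

Hence, for m ≥ 1, if L^(α) has m points and K^(α) has more, evaluation on L^(α) embeds E^(m+1) into
F^m, which is excluded (`ncard_iteratedDerivedSet_le`). By symmetry finite derived sets have equal
cardinalities, and the Mazurkiewicz–Sierpiński classification (`matchingAtRank`) gives the
homeomorphism. -/

noncomputable section

open Set Filter

/-! ### Cantor–Bendixson derived sets of countable compact spaces. -/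

section IteratedDerivedSet

/-- The iterated (Cantor–Bendixson) derived sets of a space: `x` lies in the `α`-th derived set
if it is an accumulation point of the `β`-th derived set for all `β < α`. -/
def iteratedDerivedSet (X : Type*) [TopologicalSpace X] (α : Ordinal.{0}) : Set X :=
  {x | ∀ β, β < α → AccPt x (𝓟 (iteratedDerivedSet X β))}
termination_by α

variable {X : Type*} [TopologicalSpace X]

theorem mem_iteratedDerivedSet {α : Ordinal.{0}} {x : X} :
    x ∈ iteratedDerivedSet X α ↔ ∀ β < α, AccPt x (𝓟 (iteratedDerivedSet X β)) := by
  rw [iteratedDerivedSet]; rfl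

theorem iteratedDerivedSet_anti {α β : Ordinal.{0}} (h : α ≤ β) :
    iteratedDerivedSet X β ⊆ iteratedDerivedSet X α := fun _ hx =>
  mem_iteratedDerivedSet.2 fun γ hγ => mem_iteratedDerivedSet.1 hx γ (hγ.trans_le h)

theorem iteratedDerivedSet_zero : iteratedDerivedSet X 0 = univ :=
  eq_univ_of_forall fun _ => mem_iteratedDerivedSet.2 fun β hβ => absurd hβ (by simp)

theorem iteratedDerivedSet_eq_iInter (α : Ordinal.{0}) :
    iteratedDerivedSet X α = ⋂ β : Iio α, derivedSet (iteratedDerivedSet X β) := by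
  ext x
  simp [mem_iteratedDerivedSet, derivedSet]

theorem isClosed_iteratedDerivedSet [T1Space X] (α : Ordinal.{0}) :
    IsClosed (iteratedDerivedSet X α) := by
  rw [iteratedDerivedSet_eq_iInter]
  exact isClosed_iInter fun β => isClosed_derivedSet _

theorem exists_mem_inter_ne_of_mem_iteratedDerivedSet {α β : Ordinal.{0}} (h : β < α) {x : X}
    (hx : x ∈ iteratedDerivedSet X α) {U : Set X} (hU : IsOpen U) (hxU : x ∈ U) :
    ∃ y ∈ U, y ∈ iteratedDerivedSet X β ∧ y ≠ x := by
  have := accPt_iff_nhds.1 (mem_iteratedDerivedSet.1 hx β h) U (hU.mem_nhds hxU)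
  obtain ⟨y, hy, hne⟩ := this
  exact ⟨y, hy.1, hy.2, hne⟩

/-- If a nonempty closed set misses the `γ`-th derived set, then it meets some earlier derived set in a nonempty finite set. -/
theorem exists_finite_inter_iteratedDerivedSet [CompactSpace X] [T1Space X] {G : Set X}
    (hG : IsClosed G) (hne : G.Nonempty) {γ : Ordinal.{0}}
    (hγ : G ∩ iteratedDerivedSet X γ = ∅) :
    ∃ β < γ, (G ∩ iteratedDerivedSet X β).Nonempty ∧ (G ∩ iteratedDerivedSet X β).Finite := by
  obtain ⟨δ, hδ, hmin⟩ := exists_minimal_of_wellFoundedLT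
    (fun γ' : Ordinal.{0} => G ∩ iteratedDerivedSet X γ' = ∅) ⟨γ, hγ⟩
  have hδγ : δ ≤ γ := by
    by_contra h
    exact h (hmin hγ (not_le.1 h).le)
  have hlt : ∀ β < δ, (G ∩ iteratedDerivedSet X β).Nonempty := fun β hβ =>
    nonempty_iff_ne_empty.2 fun h => not_lt_of_ge (hmin h hβ.le) hβ
  have hδ0 : δ ≠ 0 := by
    rintro rfl
    rw [iteratedDerivedSet_zero, inter_univ] at hδ
    exact hne.ne_empty hδ
  -- Otherwise these sets are a decreasing family of nonempty compact sets with intersection `G ∩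
  -- iteratedDerivedSet X δ`, which is empty. Successor and limit `δ` are covered alike.
  have key : ∃ β < δ, G ∩ derivedSet (iteratedDerivedSet X β) = ∅ := by
    by_contra! hcon
    have : Nonempty (Iio δ) := ⟨⟨0, by simpa [pos_iff_ne_zero] using hδ0⟩⟩
    have hdir : Directed (· ⊇ ·)
        fun β : Iio δ => G ∩ derivedSet (iteratedDerivedSet X (β : Ordinal.{0})) := by
      apply Antitone.directed_ge
      intro a b hab
      exact inter_subset_inter_right _ (derivedSet_mono _ _ (iteratedDerivedSet_anti hab))
    have := IsCompact.nonempty_iInter_of_directed_nonempty_isCompact_isClosed _ hdir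
      (fun β => hcon β β.2) (fun β => (hG.inter (isClosed_derivedSet _)).isCompact)
      (fun β => hG.inter (isClosed_derivedSet _))
    rw [← inter_iInter, ← iteratedDerivedSet_eq_iInter, hδ] at this
    exact not_nonempty_empty this
  obtain ⟨β, hβ, hβe⟩ := key
  refine ⟨β, hβ.trans_le hδγ, hlt β hβ, ?_⟩
  -- An infinite intersection would accumulate in the compact set `G`, at a point of the set just
  -- shown empty.
  by_contra hinf
  obtain ⟨x, hxG, hx⟩ := Set.Infinite.exists_accPt_of_subset_isCompact hinf hG.isCompact
    inter_subset_left
  have : x ∈ G ∩ derivedSet (iteratedDerivedSet X β) :=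
    ⟨hxG, derivedSet_mono _ _ inter_subset_right hx⟩
  rw [hβe] at this
  exact this

variable [CompactSpace X] [T2Space X] [Countable X]

theorem exists_isClopen_subset_of_countable {x : X} {U : Set X} (hU : IsOpen U) (hx : x ∈ U) :
    ∃ V : Set X, IsClopen V ∧ x ∈ V ∧ V ⊆ U :=
  compact_exists_isClopen_in_isOpen hU hx

/-- Baire category: a nonempty countable compact Hausdorff space is a countable union of closed
singletons, so one of them has interior. -/
theorem exists_isolated_of_countable {S : Set X} (hS : IsClosed S) (hne : S.Nonempty) :
    ∃ x, ∃ U : Set X, IsClopen U ∧ x ∈ U ∧ U ∩ S = {x} := by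
  have : Nonempty S := hne.to_subtype
  have : CompactSpace S := isCompact_iff_compactSpace.1 hS.isCompact
  obtain ⟨x, y, hy⟩ := nonempty_interior_of_iUnion_of_closed (X := S)
    (f := fun x : S => ({x} : Set S)) (fun x => isClosed_singleton) (by ext; simp)
  obtain rfl : y = x := interior_subset (s := ({x} : Set S)) hy
  obtain ⟨O, hO, hOe⟩ := isOpen_induced_iff.1 (isOpen_interior (s := ({y} : Set S)))
  have hyO : (y : X) ∈ O := by
    have : y ∈ Subtype.val ⁻¹' O := hOe ▸ hy
    exact this
  obtain ⟨V, hV, hyV, hVO⟩ := exists_isClopen_subset_of_countable hO hyO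
  refine ⟨y, V, hV, hyV, ?_⟩
  ext z
  refine ⟨fun hz => ?_, fun hz => ?_⟩
  · have : (⟨z, hz.2⟩ : S) ∈ interior ({y} : Set S) := by
      rw [← hOe]; exact hVO hz.1
    exact congrArg Subtype.val (interior_subset (s := ({y} : Set S)) this)
  · rw [mem_singleton_iff.1 hz]; exact ⟨hyV, y.2⟩

/-- A point isolated in the `α`-th derived set lies in no later one. If no derived set were empty,
choosing such points would inject the ordinals into the countable space. -/
theorem exists_iteratedDerivedSet_eq_empty :
    ∃ α, iteratedDerivedSet X α = ∅ := by
  by_contra! hcon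
  have key : ∀ α : Ordinal.{0}, ∃ x, x ∈ iteratedDerivedSet X α ∧
      ∀ β, α < β → x ∉ iteratedDerivedSet X β := by
    intro α
    obtain ⟨x, U, hU, hxU, hUe⟩ :=
      exists_isolated_of_countable (isClosed_iteratedDerivedSet α) (hcon α)
    have hx : x ∈ U ∩ iteratedDerivedSet X α := by rw [hUe]; rfl
    refine ⟨x, hx.2, fun β hβ hxβ => ?_⟩
    obtain ⟨y, hyU, hyα, hne⟩ :=
      exists_mem_inter_ne_of_mem_iteratedDerivedSet hβ hxβ hU.isOpen hxU
    have : y ∈ U ∩ iteratedDerivedSet X α := ⟨hyU, hyα⟩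
    rw [hUe] at this
    exact hne this
  choose f hf hf' using key
  -- Passing to `ℕ` brings the target into universe 0, that of the ordinals used, whatever the
  -- universe of `X`.
  obtain ⟨g, hg⟩ := Countable.exists_injective_nat X
  refine not_injective_of_ordinal.{0} (fun α => g (f α)) (hg.comp ?_)
  intro α β hab
  rcases lt_trichotomy α β with h | h | h
  · exact absurd (hab ▸ hf β) (hf' α β h)
  · exact h
  · exact absurd (hab ▸ hf α) (hf' β α h)

/-- A clopen neighbourhood of a point of the `α`-th derived set contains, away from the point, a
clopen set which meets the `β`-th derived set in exactly `n` points. -/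
theorem exists_isClopen_ncard_inter_eq {α β : Ordinal.{0}} (h : β < α) {x : X}
    (hx : x ∈ iteratedDerivedSet X α) {U : Set X} (hU : IsClopen U) (hxU : x ∈ U) (n : ℕ) :
    ∃ Q ⊆ U, IsClopen Q ∧ x ∉ Q ∧ (Q ∩ iteratedDerivedSet X β).Finite ∧
      (Q ∩ iteratedDerivedSet X β).ncard = n := by
  induction n with
  | zero => exact ⟨∅, empty_subset _, isClopen_empty, by simp, by simp, by simp⟩
  | succ n ih =>
    obtain ⟨Q, hQU, hQ, hxQ, hfin, hcard⟩ := ih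
    obtain ⟨y, hyU, hyβ, hyx⟩ := exists_mem_inter_ne_of_mem_iteratedDerivedSet h hx
      (hU.diff hQ).isOpen ⟨hxU, hxQ⟩
    obtain ⟨V, hV, hyV, hVsub⟩ := exists_isClopen_subset_of_countable
      ((hU.diff hQ).isOpen.sdiff isClosed_singleton) (show y ∈ (U \ Q) \ {x} from ⟨hyU, hyx⟩)
    -- `V` may contain many points of the derived set; isolating one of them makes the count grow by
    -- exactly one.
    obtain ⟨z, W, hW, hzW, hWe⟩ := exists_isolated_of_countable
      (hV.isClosed.inter (isClosed_iteratedDerivedSet (X := X) β)) ⟨y, hyV, hyβ⟩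
    have hzV : z ∈ W ∩ (V ∩ iteratedDerivedSet X β) := by rw [hWe]; rfl
    have hWV : (W ∩ V) ∩ iteratedDerivedSet X β = {z} := by rw [inter_assoc, hWe]
    have hunion : (Q ∪ W ∩ V) ∩ iteratedDerivedSet X β
        = insert z (Q ∩ iteratedDerivedSet X β) := by
      rw [union_inter_distrib_right, hWV, union_comm, singleton_union]
    have hzQ : z ∉ Q := (hVsub hzV.2.1).1.2
    refine ⟨Q ∪ W ∩ V, union_subset hQU fun w hw => (hVsub hw.2).1.1, hQ.union (hW.inter hV), ?_,
      ?_, ?_⟩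
    · rintro (h | h)
      · exact hxQ h
      · exact (hVsub h.2).2 rfl
    · rw [hunion]; exact hfin.insert z
    · rw [hunion, ncard_insert_of_notMem (fun h => hzQ h.1) hfin, hcard]

/-- There are infinitely many pairwise disjoint clopen sets meeting the `β`-th derived set in each
clopen neighbourhood of a point of a later derived set. -/
theorem exists_seq_isClopen_disjoint {α β : Ordinal.{0}} (h : β < α) {x : X}
    (hx : x ∈ iteratedDerivedSet X α) {U : Set X} (hU : IsClopen U) (hxU : x ∈ U) :
    ∃ V : ℕ → Set X, (∀ n, V n ⊆ U ∧ IsClopen (V n) ∧ (V n ∩ iteratedDerivedSet X β).Nonempty) ∧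
      Pairwise (Function.onFun Disjoint V) := by
  -- Requiring `x ∉ V` leaves `x` outside the finitely many sets already chosen, so that the choice
  -- can continue.
  obtain ⟨V, hV, hd⟩ := exists_seq_of_forall_finset_exists'
    (fun V : Set X => V ⊆ U ∧ IsClopen V ∧ x ∉ V ∧ (V ∩ iteratedDerivedSet X β).Nonempty)
    Disjoint (by
      intro s hs
      have hcl : IsClopen (⋃ V ∈ s, V) := s.finite_toSet.isClopen_biUnion fun V hV => (hs V hV).2.1
      have hxs : x ∉ ⋃ V ∈ s, V := by
        simp only [mem_iUnion, not_exists]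
        exact fun V hV => (hs V hV).2.2.1
      obtain ⟨Q, hQU, hQ, hxQ, hfin, hcard⟩ :=
        exists_isClopen_ncard_inter_eq h hx (hU.diff hcl) ⟨hxU, hxs⟩ 1
      refine ⟨Q, ⟨fun z hz => (hQU hz).1, hQ, hxQ, ?_⟩, fun V hV => ?_⟩
      · exact nonempty_of_ncard_ne_zero (by rw [hcard]; exact one_ne_zero)
      · rw [disjoint_left]
        intro z hzV hzQ
        exact (hQU hzQ).2 (mem_biUnion (show V ∈ (s : Set (Set X)) from hV) hzV))
  exact ⟨V, fun n => ⟨(hV n).1, (hV n).2.1, (hV n).2.2.2⟩, hd⟩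

theorem exists_isClopen_inter_eq_singleton {A D : Set X} (hA : IsClopen A) (hfin : (A ∩ D).Finite)
    {x : X} (hx : x ∈ A ∩ D) : ∃ A' ⊆ A, IsClopen A' ∧ A' ∩ D = {x} := by
  obtain ⟨V, hV, hxV, hVsub⟩ := exists_isClopen_subset_of_countable
    (hA.isOpen.sdiff (hfin.sdiff (t := {x})).isClosed)
    (show x ∈ A \ ((A ∩ D) \ {x}) from ⟨hx.1, fun h => h.2 rfl⟩)
  refine ⟨V, fun z hz => (hVsub hz).1, hV, ?_⟩
  ext z
  refine ⟨fun hz => ?_, fun hz => ?_⟩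
  · by_contra hne
    exact (hVsub hz.1).2 ⟨⟨(hVsub hz.1).1, hz.2⟩, hne⟩
  · rw [mem_singleton_iff.1 hz]; exact ⟨hxV, hx.2⟩

end IteratedDerivedSet

/-! ### The Mazurkiewicz–Sierpiński classification by back-and-forth. -/

section ClopenMatching

variable {X Y : Type*} [TopologicalSpace X] [TopologicalSpace Y]

/-- The map `f` restricts to a continuous bijection from `A` onto `B`. -/
def IsMatching (f : X → Y) (A : Set X) (B : Set Y) : Prop :=
  ContinuousOn f A ∧ BijOn f A B

open Classical in
theorem IsMatching.glue {f g : X → Y} {A A' : Set X} {B B' : Set Y} (hf : IsMatching f A B)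
    (hg : IsMatching g A' B') (hA : IsOpen A) (hA' : IsOpen A') (hAA' : Disjoint A A')
    (hBB' : Disjoint B B') : ∃ h, IsMatching h (A ∪ A') (B ∪ B') ∧ EqOn h f A := by
  have h1 : EqOn (A.piecewise f g) f A := piecewise_eqOn A f g
  have h2 : EqOn (A.piecewise f g) g A' :=
    (piecewise_eqOn_compl A f g).mono (disjoint_right.1 hAA')
  have hB1 : BijOn (A.piecewise f g) A B := hf.2.congr h1.symm
  have hB2 : BijOn (A.piecewise f g) A' B' := hg.2.congr h2.symm
  refine ⟨A.piecewise f g, ⟨?_, hB1.union hB2 ?_⟩, h1⟩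
  · exact (hf.1.congr h1).union_of_isOpen (hg.1.congr h2) hA hA'
  · rw [injOn_union hAA']
    exact ⟨hB1.injOn, hB2.injOn, fun a ha b hb hab =>
      disjoint_left.1 hBB' (hB1.mapsTo ha) (hab ▸ hB2.mapsTo hb)⟩

/-- Gluing an increasing sequence of matchings that exhausts the complements of two points. -/
theorem exists_isMatching_of_exhaustion [CompactSpace Y] {A : Set X} {B : Set Y} (hB : IsClosed B)
    {x : X} {y : Y} (hyB : y ∈ B) (hxA : x ∈ A)
    {S : ℕ → Set X} {R : ℕ → Set Y} {f : ℕ → X → Y} (hS : ∀ n, IsClopen (S n))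
    (hR : ∀ n, IsOpen (R n)) (hf : ∀ n, IsMatching (f n) (S n) (R n)) (hmono : Monotone S)
    (hRmono : Monotone R)
    (heq : ∀ m n, m ≤ n → EqOn (f n) (f m) (S m)) (hSA : ⋃ n, S n = A \ {x})
    (hRB : ⋃ n, R n = B \ {y}) : ∃ g, IsMatching g A B := by
  classical
  -- The default value `y` is the one needed at `x`, the only point of `A` outside every `S n`.
  let g : X → Y := fun z => if h : ∃ n, z ∈ S n then f (Nat.find h) z else y
  have hg : ∀ n, EqOn g (f n) (S n) := by
    intro n z hz
    have h : ∃ n, z ∈ S n := ⟨n, hz⟩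
    simp only [g, dif_pos h]
    exact (heq _ _ (Nat.find_min' h hz) (Nat.find_spec h)).symm
  have hxS : ∀ n, x ∉ S n := fun n hn => by
    have : x ∈ A \ {x} := hSA ▸ mem_iUnion_of_mem n hn
    exact this.2 rfl
  have hyR : ∀ n, y ∉ R n := fun n hn => by
    have : y ∈ B \ {y} := hRB ▸ mem_iUnion_of_mem n hn
    exact this.2 rfl
  have hgx : g x = y := dif_neg (by simpa using hxS)
  have hcase : ∀ z ∈ A, z = x ∨ ∃ n, z ∈ S n := by
    intro z hz
    by_cases h : z = x
    · exact Or.inl h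
    · have : z ∈ ⋃ n, S n := hSA ▸ ⟨hz, h⟩
      exact Or.inr (mem_iUnion.1 this)
  have hgR : ∀ n, ∀ z ∈ S n, g z ∈ R n := fun n z hz => by
    rw [hg n hz]; exact (hf n).2.mapsTo hz
  have hinj : ∀ n, InjOn g (S n) := fun n => (hf n).2.injOn.congr (hg n).symm
  refine ⟨g, ?_, ?_, ?_, ?_⟩
  · intro z hz
    rcases hcase z hz with rfl | ⟨n, hn⟩
    · rw [ContinuousWithinAt, hgx]
      refine fun O hO => ?_
      obtain ⟨O', hO'O, hO', hyO'⟩ := mem_nhds_iff.1 hO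
      -- Continuity at `x`: by compactness one `R n` covers `B \ O'`. As `S n` already maps onto `R
      -- n`, injectivity forces points of `A` outside `S n` into `O'`.
      obtain ⟨n, hn⟩ := (hB.sdiff hO').isCompact.elim_directed_cover R hR
        (by rw [hRB]; exact fun w hw => ⟨hw.1, fun h => hw.2 (mem_singleton_iff.1 h ▸ hyO')⟩)
        hRmono.directed_le
      have hnhds : (S n)ᶜ ∩ A ∈ 𝓝[A] z :=
        inter_mem (mem_nhdsWithin_of_mem_nhds ((hS n).compl.isOpen.mem_nhds (hxS n)))
          self_mem_nhdsWithin
      refine mem_map.2 (mem_of_superset hnhds ?_)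
      rintro w ⟨hwS, hwA⟩
      refine hO'O ?_
      by_contra hwO
      rcases hcase w hwA with rfl | ⟨m, hm⟩
      · exact hwO (hgx ▸ hyO')
      · have hwB : g w ∈ B \ {y} := hRB ▸ mem_iUnion_of_mem m (hgR m w hm)
        have hwR : g w ∈ R n := hn ⟨hwB.1, hwO⟩
        obtain ⟨w', hw', hww'⟩ := (hf n).2.surjOn hwR
        rw [← hg n hw'] at hww'
        have := hinj (max n m) (hmono (le_max_left _ _) hw') (hmono (le_max_right _ _) hm) hww'
        exact hwS (this ▸ hw')
    · have h1 : ContinuousAt (f n) z := (hf n).1.continuousAt ((hS n).isOpen.mem_nhds hn)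
      have h2 : f n =ᶠ[𝓝 z] g :=
        Filter.eventually_of_mem ((hS n).isOpen.mem_nhds hn) fun w hw => (hg n hw).symm
      exact (h1.congr h2).continuousWithinAt
  · intro z hz
    rcases hcase z hz with rfl | ⟨n, hn⟩
    · rwa [hgx]
    · have : g z ∈ B \ {y} := hRB ▸ mem_iUnion_of_mem n (hgR n z hn)
      exact this.1
  · intro z hz w hw hzw
    rcases hcase z hz with rfl | ⟨n, hn⟩ <;> rcases hcase w hw with rfl | ⟨m, hm⟩
    · rfl
    · exact absurd (hgR m w hm) (by rw [← hzw, hgx]; exact hyR m)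
    · exact absurd (hgR n z hn) (by rw [hzw, hgx]; exact hyR n)
    · exact hinj (max n m) (hmono (le_max_left _ _) hn) (hmono (le_max_right _ _) hm) hzw
  · intro w hw
    by_cases h : w = y
    · exact ⟨x, hxA, by rw [hgx, h]⟩
    · have : w ∈ ⋃ n, R n := hRB ▸ ⟨hw, h⟩
      obtain ⟨n, hn⟩ := mem_iUnion.1 this
      obtain ⟨z, hz, rfl⟩ := (hf n).2.surjOn hn
      have hzA : z ∈ A \ {x} := hSA ▸ mem_iUnion_of_mem n hz
      exact ⟨z, hzA.1, hg n hz⟩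

variable [CompactSpace X] [T2Space X] [CompactSpace Y] [T2Space Y] [Countable Y]

/-- A clopen set of rank below `α` has the same rank type as some clopen set near a given point of
the `α`-th derived set of another space. -/
theorem exists_isClopen_same_type {α : Ordinal.{0}} {P : Set X} (hP : IsClopen P)
    (hne : P.Nonempty) (hPα : P ∩ iteratedDerivedSet X α = ∅) {y : Y}
    (hy : y ∈ iteratedDerivedSet Y α) {U : Set Y} (hU : IsClopen U) (hyU : y ∈ U) :
    ∃ Q ⊆ U, IsClopen Q ∧ y ∉ Q ∧ ∃ β < α, (P ∩ iteratedDerivedSet X β).Nonempty ∧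
      (P ∩ iteratedDerivedSet X β).Finite ∧ (Q ∩ iteratedDerivedSet Y β).Finite ∧
      (P ∩ iteratedDerivedSet X β).ncard = (Q ∩ iteratedDerivedSet Y β).ncard := by
  obtain ⟨β, hβ, hβne, hfin⟩ := exists_finite_inter_iteratedDerivedSet hP.isClosed hne hPα
  obtain ⟨Q, hQU, hQ, hyQ, hQfin, hcard⟩ := exists_isClopen_ncard_inter_eq hβ hy hU hyU
    (P ∩ iteratedDerivedSet X β).ncard
  exact ⟨Q, hQU, hQ, hyQ, β, hβ, hβne, hfin, hQfin, hcard.symm⟩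

variable [Countable X]

/-- Clopen sets with the same finite nonzero number of points in the `β`-th derived set match. -/
def MatchingAtRank (X Y : Type*) [TopologicalSpace X] [TopologicalSpace Y]
    (β : Ordinal.{0}) : Prop :=
  ∀ (A : Set X) (B : Set Y), IsClopen A → IsClopen B → (A ∩ iteratedDerivedSet X β).Nonempty →
    (A ∩ iteratedDerivedSet X β).Finite → (B ∩ iteratedDerivedSet Y β).Finite →
    (A ∩ iteratedDerivedSet X β).ncard = (B ∩ iteratedDerivedSet Y β).ncard →
    ∃ f, IsMatching f A B

/-- Back-and-forth: clopen pieces of `A \ {x}` and `B \ {y}` have rank below `α`. Each has a partner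
of the same type near the opposite distinguished point, disjoint from what is already matched, and
`ih` matches the pair. Enumerating both spaces exhausts the two complements. -/
theorem exists_isMatching_singleton {α : Ordinal.{0}} (ih : ∀ β < α, MatchingAtRank X Y β)
    {A : Set X} {B : Set Y} (hA : IsClopen A) (hB : IsClopen B) {x : X} {y : Y}
    (hAx : A ∩ iteratedDerivedSet X α = {x}) (hBy : B ∩ iteratedDerivedSet Y α = {y}) :
    ∃ f, IsMatching f A B := by
  have hx : x ∈ A ∩ iteratedDerivedSet X α := by rw [hAx]; rfl
  have hy : y ∈ B ∩ iteratedDerivedSet Y α := by rw [hBy]; rfl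
  let Good : Set X × Set Y × (X → Y) → Prop := fun t =>
    IsClopen t.1 ∧ t.1 ⊆ A \ {x} ∧ IsClopen t.2.1 ∧ t.2.1 ⊆ B \ {y} ∧
      IsMatching t.2.2 t.1 t.2.1
  let Ext : Set X × Set Y × (X → Y) → Set X × Set Y × (X → Y) → Prop := fun t t' =>
    t.1 ⊆ t'.1 ∧ t.2.1 ⊆ t'.2.1 ∧ EqOn t'.2.2 t.2.2 t.1
  have hrefl : ∀ t, Ext t t := fun t => ⟨subset_rfl, subset_rfl, eqOn_refl _ _⟩
  have htrans : ∀ t t' t'', Ext t t' → Ext t' t'' → Ext t t'' := fun t t' t'' h h' =>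
    ⟨h.1.trans h'.1, h.2.1.trans h'.2.1, (h'.2.2.mono h.1).trans h.2.2⟩
  have glue : ∀ t, Good t → ∀ P Q β, β < α → IsClopen P → P ⊆ (A \ {x}) \ t.1 → IsClopen Q →
      Q ⊆ (B \ {y}) \ t.2.1 → (P ∩ iteratedDerivedSet X β).Nonempty →
      (P ∩ iteratedDerivedSet X β).Finite → (Q ∩ iteratedDerivedSet Y β).Finite →
      (P ∩ iteratedDerivedSet X β).ncard = (Q ∩ iteratedDerivedSet Y β).ncard →
      ∃ t', Good t' ∧ Ext t t' ∧ P ⊆ t'.1 ∧ Q ⊆ t'.2.1 := by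
    rintro ⟨S, R, f⟩ ⟨hS, hSA, hR, hRB, hf⟩ P Q β hβ hP hPS hQ hQR hne hfin hfin' hcard
    obtain ⟨g, hg⟩ := ih β hβ P Q hP hQ hne hfin hfin' hcard
    obtain ⟨h, hh, heq⟩ := hf.glue hg hS.isOpen hP.isOpen
      (disjoint_right.2 fun z hz => (hPS hz).2) (disjoint_right.2 fun z hz => (hQR hz).2)
    exact ⟨(S ∪ P, R ∪ Q, h), ⟨hS.union hP, union_subset hSA fun z hz => (hPS hz).1, hR.union hQ,
      union_subset hRB fun z hz => (hQR hz).1, hh⟩,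
      ⟨subset_union_left, subset_union_left, heq⟩, subset_union_right, subset_union_right⟩
  have forth : ∀ t, Good t → ∀ z ∈ A \ {x}, ∃ t', Good t' ∧ Ext t t' ∧ z ∈ t'.1 := by
    intro t ht z hz
    by_cases hzt : z ∈ t.1
    · exact ⟨t, ht, hrefl t, hzt⟩
    obtain ⟨P, hP, hzP, hPsub⟩ := exists_isClopen_subset_of_countable
      ((hA.isOpen.sdiff isClosed_singleton).sdiff ht.1.isClosed) ⟨hz, hzt⟩
    have hPα : P ∩ iteratedDerivedSet X α = ∅ := by
      by_contra hcon
      obtain ⟨w, hw⟩ := nonempty_iff_ne_empty.2 hcon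
      have : w ∈ A ∩ iteratedDerivedSet X α := ⟨(hPsub hw.1).1.1, hw.2⟩
      rw [hAx] at this
      exact (hPsub hw.1).1.2 this
    obtain ⟨Q, hQU, hQ, hyQ, β, hβ, hne, hfin, hfin', hcard⟩ :=
      exists_isClopen_same_type hP ⟨z, hzP⟩ hPα hy.2 (hB.diff ht.2.2.1)
        ⟨hy.1, fun h => (ht.2.2.2.1 h).2 rfl⟩
    obtain ⟨t', h1, h2, h3, -⟩ := glue t ht P Q β hβ hP hPsub hQ
      (fun w hw => ⟨⟨(hQU hw).1, fun h => hyQ (mem_singleton_iff.1 h ▸ hw)⟩, (hQU hw).2⟩)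
      hne hfin hfin' hcard
    exact ⟨t', h1, h2, h3 hzP⟩
  have back : ∀ t, Good t → ∀ z ∈ B \ {y}, ∃ t', Good t' ∧ Ext t t' ∧ z ∈ t'.2.1 := by
    intro t ht z hz
    by_cases hzt : z ∈ t.2.1
    · exact ⟨t, ht, hrefl t, hzt⟩
    obtain ⟨Q, hQ, hzQ, hQsub⟩ := exists_isClopen_subset_of_countable
      ((hB.isOpen.sdiff isClosed_singleton).sdiff ht.2.2.1.isClosed) ⟨hz, hzt⟩
    have hQα : Q ∩ iteratedDerivedSet Y α = ∅ := by
      by_contra hcon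
      obtain ⟨w, hw⟩ := nonempty_iff_ne_empty.2 hcon
      have : w ∈ B ∩ iteratedDerivedSet Y α := ⟨(hQsub hw.1).1.1, hw.2⟩
      rw [hBy] at this
      exact (hQsub hw.1).1.2 this
    obtain ⟨P, hPU, hP, hxP, β, hβ, hne, hfin, hfin', hcard⟩ :=
      exists_isClopen_same_type hQ ⟨z, hzQ⟩ hQα hx.2 (hA.diff ht.1)
        ⟨hx.1, fun h => (ht.2.1 h).2 rfl⟩
    obtain ⟨t', h1, h2, -, h3⟩ := glue t ht P Q β hβ hP
      (fun w hw => ⟨⟨(hPU hw).1, fun h => hxP (mem_singleton_iff.1 h ▸ hw)⟩, (hPU hw).2⟩) hQ hQsub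
      (nonempty_of_ncard_ne_zero (by
        rw [← hcard]; exact ((ncard_pos hfin).2 hne).ne')) hfin' hfin hcard.symm
    exact ⟨t', h1, h2, h3 hzQ⟩
  have : Nonempty X := ⟨x⟩
  have : Nonempty Y := ⟨y⟩
  obtain ⟨u, hu⟩ := exists_surjective_nat X
  obtain ⟨v, hv⟩ := exists_surjective_nat Y
  have step : ∀ (n : ℕ) (t : {t // Good t}), ∃ t' : {t // Good t}, Ext t.1 t'.1 ∧
      (u n ∈ A \ {x} → u n ∈ t'.1.1) ∧ (v n ∈ B \ {y} → v n ∈ t'.1.2.1) := by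
    rintro n ⟨t, ht⟩
    obtain ⟨t₁, ht₁, hext₁, hu₁⟩ : ∃ t', Good t' ∧ Ext t t' ∧ (u n ∈ A \ {x} → u n ∈ t'.1) := by
      by_cases h : u n ∈ A \ {x}
      · obtain ⟨t', h1, h2, h3⟩ := forth t ht _ h
        exact ⟨t', h1, h2, fun _ => h3⟩
      · exact ⟨t, ht, hrefl t, fun h' => absurd h' h⟩
    by_cases h : v n ∈ B \ {y}
    · obtain ⟨t', h1, h2, h3⟩ := back t₁ ht₁ _ h
      exact ⟨⟨t', h1⟩, htrans _ _ _ hext₁ h2, fun h' => h2.1 (hu₁ h'), fun _ => h3⟩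
    · exact ⟨⟨t₁, ht₁⟩, hext₁, hu₁, fun h' => absurd h' h⟩
  choose F hF using step
  have t₀ : {t // Good t} := ⟨(∅, ∅, fun _ => y), isClopen_empty, empty_subset _, isClopen_empty,
    empty_subset _, continuousOn_empty _, bijOn_empty _⟩
  let σ : ℕ → {t // Good t} := fun n => Nat.rec t₀ F n
  have hσ : ∀ n, σ (n + 1) = F n (σ n) := fun n => rfl
  have hext : ∀ m n, m ≤ n → Ext (σ m).1 (σ n).1 := by
    intro m n hmn
    induction n, hmn using Nat.le_induction with
    | base => exact hrefl _
    | succ n _ ihn => exact htrans _ _ _ ihn (hF n (σ n)).1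
  refine exists_isMatching_of_exhaustion (S := fun n => (σ n).1.1) (R := fun n => (σ n).1.2.1)
    (f := fun n => (σ n).1.2.2) hB.isClosed hy.1 hx.1 (fun n => (σ n).2.1)
    (fun n => (σ n).2.2.2.1.isOpen) (fun n => (σ n).2.2.2.2.2) (fun m n h => (hext m n h).1)
    (fun m n h => (hext m n h).2.1) (fun m n h => (hext m n h).2.2) ?_ ?_
  · refine subset_antisymm (iUnion_subset fun n => (σ n).2.2.1) fun z hz => ?_
    obtain ⟨n, rfl⟩ := hu z
    -- The point `u n` is absorbed during step `n`, hence belongs to stage `n + 1`.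
    exact mem_iUnion_of_mem (n + 1) ((hF n (σ n)).2.1 hz)
  · refine subset_antisymm (iUnion_subset fun n => (σ n).2.2.2.2.1) fun z hz => ?_
    obtain ⟨n, rfl⟩ := hv z
    exact mem_iUnion_of_mem (n + 1) ((hF n (σ n)).2.2 hz)

/-- The Mazurkiewicz–Sierpiński classification: countable compact spaces with the same rank and
the same number of points of maximal rank are homeomorphic. -/
theorem matchingAtRank (α : Ordinal.{0}) : MatchingAtRank X Y α := by
  induction α using WellFoundedLT.induction with
  | ind α ih =>
    intro A B hA hB hne hfin hfin' hcard
    generalize hn : (A ∩ iteratedDerivedSet X α).ncard = n at hcard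
    induction n generalizing A B with
    | zero => exact absurd hn ((ncard_pos hfin).2 hne).ne'
    | succ n ihn =>
      obtain ⟨x, hx⟩ := hne
      obtain ⟨y, hy⟩ : (B ∩ iteratedDerivedSet Y α).Nonempty :=
        nonempty_of_ncard_ne_zero (by rw [← hcard]; exact n.succ_ne_zero)
      obtain ⟨A', hA'A, hA', hA'x⟩ := exists_isClopen_inter_eq_singleton hA hfin hx
      obtain ⟨B', hB'B, hB', hB'y⟩ := exists_isClopen_inter_eq_singleton hB hfin' hy
      have hA2 : (A \ A') ∩ iteratedDerivedSet X α = (A ∩ iteratedDerivedSet X α) \ {x} := by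
        rw [← hA'x]; ext z; simp only [mem_inter_iff, Set.mem_sdiff]; tauto
      have hB2 : (B \ B') ∩ iteratedDerivedSet Y α = (B ∩ iteratedDerivedSet Y α) \ {y} := by
        rw [← hB'y]; ext z; simp only [mem_inter_iff, Set.mem_sdiff]; tauto
      have hcA : ((A \ A') ∩ iteratedDerivedSet X α).ncard = n := by
        rw [hA2, ncard_sdiff_singleton_of_mem hx, hn, Nat.add_sub_cancel]
      have hcB : ((B \ B') ∩ iteratedDerivedSet Y α).ncard = n := by
        rw [hB2, ncard_sdiff_singleton_of_mem hy, ← hcard, Nat.add_sub_cancel]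
      obtain ⟨f, hf⟩ := exists_isMatching_singleton ih hA' hB' hA'x hB'y
      -- For `n = 0` the remainders `A \ A'` and `B \ B'` need not match, as they have only lower
      -- rank; the one-point case is applied to all of `A` and `B` instead.
      rcases Nat.eq_zero_or_pos n with rfl | hpos
      · obtain ⟨x', hx'⟩ := ncard_eq_one.1 hn
        obtain ⟨y', hy'⟩ := ncard_eq_one.1 hcard.symm
        exact exists_isMatching_singleton ih hA hB hx' hy'
      · obtain ⟨g, hg⟩ := ihn (A \ A') (B \ B') (hA.diff hA') (hB.diff hB')
          (nonempty_of_ncard_ne_zero (by rw [hcA]; exact hpos.ne'))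
          (hA2 ▸ hfin.sdiff) (hB2 ▸ hfin'.sdiff) hcA hcB.symm
        obtain ⟨h, hh, -⟩ := hf.glue hg hA'.isOpen (hA.diff hA').isOpen disjoint_sdiff_right
          disjoint_sdiff_right
        rw [union_sdiff_cancel hA'A, union_sdiff_cancel hB'B] at hh
        exact ⟨h, hh⟩

end ClopenMatching

/-! ### Disjointification and copies of c₀. -/

section CZero

theorem containsIsomorphicCopy_of_bounds {X Y : Type*} [NormedAddCommGroup X] [NormedSpace ℝ X]
    [NormedAddCommGroup Y] [NormedSpace ℝ Y] (J : Y →ₗ[ℝ] X) {C η : ℝ} (hη : 0 < η)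
    (hC : ∀ y, ‖J y‖ ≤ C * ‖y‖) (hJ : ∀ y, η * ‖y‖ ≤ ‖J y‖) : ContainsIsomorphicCopy X Y := by
  have hinj : Function.Injective J := by
    refine (injective_iff_map_eq_zero J).2 fun y hy => ?_
    have := hJ y
    rw [hy, norm_zero] at this
    exact norm_le_zero_iff.1 (nonpos_of_mul_nonpos_right this hη)
  refine ⟨LinearMap.range J, ⟨(LinearEquiv.ofInjective J hinj).toContinuousLinearEquivOfBounds C η⁻¹
    (fun y => hC y) fun z => ?_⟩⟩
  obtain ⟨y, rfl⟩ := (LinearEquiv.ofInjective J hinj).surjective z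
  rw [LinearEquiv.symm_apply_apply, inv_mul_eq_div, le_div_iff₀' hη]
  exact hJ y

/-- Rosenthal's disjointification lemma for matrices with uniformly bounded row sums. -/
theorem exists_injective_sum_off_diagonal_le {ε : ℝ} (hε : 0 < ε) (a : ℕ → ℕ → ℝ)
    {C : ℝ} (hC : ∀ k (s : Finset ℕ), ∑ j ∈ s, a k j ≤ C) :
    ∃ σ : ℕ → ℕ, Function.Injective σ ∧
      ∀ k (s : Finset ℕ), k ∉ s → ∑ j ∈ s, a (σ k) (σ j) ≤ ε := by
  obtain ⟨N, hN⟩ := exists_nat_ge (C / ε)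
  replace hC : ∀ k (s : Finset ℕ), ∑ j ∈ s, a k j ≤ N * ε := fun k s =>
    (hC k s).trans ((div_le_iff₀ hε).1 hN)
  clear hN
  induction N generalizing a with
  | zero => exact ⟨id, Function.injective_id, fun k s _ => (hC k s).trans (by simpa using hε.le)⟩
  | succ N ih =>
    -- Split `ℕ` into infinitely many infinite blocks. If no block works, each contains an index
    -- whose sum within its own block exceeds `ε`. Among these indices, one per block, the row bound
    -- drops by `ε`, so induction on `N` applies.
    let e : ℕ → ℕ → ℕ := fun p k => Nat.pair p k
    have he : ∀ p k p' k', e p k = e p' k' → p = p' ∧ k = k' := fun p k p' k' h =>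
      Nat.pair_eq_pair.1 h
    by_cases hcase : ∃ p, ∀ k (s : Finset ℕ), k ∉ s → ∑ j ∈ s, a (e p k) (e p j) ≤ ε
    · obtain ⟨p, hp⟩ := hcase
      exact ⟨e p, fun k k' h => (he _ _ _ _ h).2, hp⟩
    · push Not at hcase
      choose K S hKS hS using hcase
      have hinj : Function.Injective fun p => e p (K p) := fun p q h => (he _ _ _ _ h).1
      obtain ⟨σ, hσ, hσs⟩ := ih (fun p q => a (e p (K p)) (e q (K q))) (by
        intro p s
        have hdisj : Disjoint (s.image fun q => e q (K q)) ((S p).image (e p)) := by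
          rw [Finset.disjoint_left]
          intro z hz hz'
          obtain ⟨q, -, rfl⟩ := Finset.mem_image.1 hz
          obtain ⟨j, hj, hjq⟩ := Finset.mem_image.1 hz'
          obtain ⟨rfl, rfl⟩ := he _ _ _ _ hjq
          exact hKS _ hj
        have h := hC (e p (K p)) ((s.image fun q => e q (K q)) ∪ (S p).image (e p))
        rw [Finset.sum_union hdisj, Finset.sum_image fun x _ y _ h => hinj h,
          Finset.sum_image fun x _ y _ h => (he _ _ _ _ h).2] at h
        have := hS p
        push_cast at h
        linarith)
      exact ⟨fun k => e (σ k) (K (σ k)), hinj.comp hσ, hσs⟩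

variable {E : Type*} [NormedAddCommGroup E] [NormedSpace ℝ E]

/-- Only finitely many coefficients reach `ε / (c + 1)`; any finite sum avoiding them has norm at
most `c * (ε / (c + 1)) < ε`. -/
theorem summable_smul_of_weakly_unconditional [CompleteSpace E] {v : ℕ → E} {c : ℝ} (hc0 : 0 ≤ c)
    (hc : ∀ (s : Finset ℕ) (a : ℕ → ℝ) (M : ℝ), 0 ≤ M → (∀ j ∈ s, |a j| ≤ M) →
      ‖∑ j ∈ s, a j • v j‖ ≤ c * M) (a : C₀(ℕ, ℝ)) : Summable fun j => a j • v j := by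
  rw [summable_iff_vanishing_norm]
  intro ε hε
  have hpos : 0 < ε / (c + 1) := by positivity
  have hev : ∀ᶠ j in cofinite, ‖a j‖ < ε / (c + 1) := by
    have := zero_at_infty a
    rw [cocompact_eq_cofinite] at this
    have h0 : ‖(0 : ℝ)‖ < ε / (c + 1) := by simpa using hpos
    exact this.norm.eventually_lt_const h0
  have hfin : {j | ¬ ‖a j‖ < ε / (c + 1)}.Finite := eventually_cofinite.1 hev
  refine ⟨hfin.toFinset, fun t ht => ?_⟩
  refine (hc t a (ε / (c + 1)) hpos.le fun j hj => ?_).trans_lt ?_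
  · by_contra hcon
    refine Finset.disjoint_left.1 ht hj ?_
    rw [Set.Finite.mem_toFinset]
    exact fun h => hcon (le_of_lt h)
  · rw [mul_div_assoc', div_lt_iff₀ (by positivity)]
    nlinarith

/-- A version of the Bessaga–Pełczyński theorem: a weakly unconditionally Cauchy series whose terms
are bounded away from zero yields a copy of `c₀`. -/
theorem containsCZero_of_weakly_unconditional [CompleteSpace E] (v : ℕ → E) {c η : ℝ} (hη : 0 < η)
    (hc : ∀ (s : Finset ℕ) (a : ℕ → ℝ) (M : ℝ), 0 ≤ M → (∀ j ∈ s, |a j| ≤ M) →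
      ‖∑ j ∈ s, a j • v j‖ ≤ c * M) (hv : ∀ j, η ≤ ‖v j‖) : ContainsCZero E := by
  have hc0 : 0 ≤ c := by simpa using (norm_nonneg _).trans (hc ∅ 0 1 zero_le_one (by simp))
  have hφ : ∀ k, ∃ φ : StrongDual ℝ E, ‖φ‖ = 1 ∧ φ (v k) = ‖v k‖ := fun k =>
    exists_dual_vector ℝ (v k) (hη.trans_le (hv k)).ne'
  choose φ hφ1 hφv using hφ
  obtain ⟨σ, hσ, hσs⟩ := exists_injective_sum_off_diagonal_le (half_pos hη)
    (fun k j => |φ k (v j)|) (C := c) (by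
      intro k s
      -- Taking signs as coefficients turns the bound on signed sums into a bound on the absolute
      -- row sums of `φ k (v j)`.
      have h := hc s (fun j => (SignType.sign (φ k (v j)) : ℝ)) 1 zero_le_one fun j _ => by
        rcases lt_trichotomy (φ k (v j)) 0 with h | h | h <;> simp [h]
      calc ∑ j ∈ s, |φ k (v j)| = φ k (∑ j ∈ s, (SignType.sign (φ k (v j)) : ℝ) • v j) := by
            rw [map_sum]
            exact Finset.sum_congr rfl fun j _ => by
              rw [map_smul, smul_eq_mul, sign_mul_self]
        _ ≤ ‖φ k (∑ j ∈ s, (SignType.sign (φ k (v j)) : ℝ) • v j)‖ := le_abs_self _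
        _ ≤ ‖φ k‖ * ‖∑ j ∈ s, (SignType.sign (φ k (v j)) : ℝ) • v j‖ := (φ k).le_opNorm _
        _ ≤ c := by rw [hφ1, one_mul]; simpa using h)
  let w : ℕ → E := v ∘ σ
  have hw : ∀ (s : Finset ℕ) (a : ℕ → ℝ) (M : ℝ), 0 ≤ M → (∀ j ∈ s, |a j| ≤ M) →
      ‖∑ j ∈ s, a j • w j‖ ≤ c * M := by
    intro s a M hM ha
    have := hc (s.map ⟨σ, hσ⟩) (Function.extend σ a 0) M hM (by
      intro j hj
      obtain ⟨i, hi, rfl⟩ := Finset.mem_map.1 hj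
      simpa [hσ.extend_apply] using ha i hi)
    simpa [w, Finset.sum_map, hσ.extend_apply] using this
  have hsum := summable_smul_of_weakly_unconditional hc0 hw
  have hbd : ∀ (a : C₀(ℕ, ℝ)) j, |a j| ≤ ‖a‖ := fun a j => by
    rw [← ZeroAtInftyContinuousMap.norm_toBCF_eq_norm]
    exact a.toBCF.norm_coe_le_norm j
  let J : C₀(ℕ, ℝ) →ₗ[ℝ] E :=
    { toFun := fun a => ∑' j, a j • w j
      map_add' := fun a b => by
        simp only [ZeroAtInftyContinuousMap.add_apply, add_smul]
        exact (hsum a).tsum_add (hsum b)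
      map_smul' := fun r a => by
        simp only [ZeroAtInftyContinuousMap.smul_apply, smul_assoc, RingHom.id_apply]
        exact (hsum a).tsum_const_smul r }
  have htend : ∀ a : C₀(ℕ, ℝ), Tendsto (fun s : Finset ℕ => ‖∑ j ∈ s, a j • w j‖) atTop
      (𝓝 ‖J a‖) := fun a => (hsum a).hasSum.norm
  refine containsIsomorphicCopy_of_bounds J (half_pos hη) (C := c) (fun a => ?_) fun a => ?_
  · exact le_of_tendsto' (htend a) fun s => hw s a _ (norm_nonneg a) fun j _ => hbd a j
  -- Test with `φ (σ k)`: the diagonal term is at least `η * |a k|` and the rest at most `η / 2 *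
  -- ‖a‖`. The supremum over `k` gives the lower bound `η / 2 * ‖a‖`.
  · have hk : ∀ k, η * |a k| - η / 2 * ‖a‖ ≤ ‖J a‖ := by
      intro k
      refine ge_of_tendsto (htend a) ?_
      filter_upwards [eventually_ge_atTop {k}] with s hs
      have hks : k ∈ s := hs (Finset.mem_singleton_self k)
      have h1 : φ (σ k) (∑ j ∈ s, a j • w j) =
          a k * ‖w k‖ + ∑ j ∈ s.erase k, a j * φ (σ k) (w j) := by
        rw [← Finset.add_sum_erase _ _ hks, map_add, map_sum, map_smul, smul_eq_mul]
        congr 2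
        · exact hφv (σ k)
        · funext j; rw [map_smul, smul_eq_mul]
      have h2 : |∑ j ∈ s.erase k, a j * φ (σ k) (w j)| ≤ η / 2 * ‖a‖ := by
        calc |∑ j ∈ s.erase k, a j * φ (σ k) (w j)|
            ≤ ∑ j ∈ s.erase k, |a j * φ (σ k) (w j)| := Finset.abs_sum_le_sum_abs _ _
          _ ≤ ∑ j ∈ s.erase k, ‖a‖ * |φ (σ k) (w j)| := Finset.sum_le_sum fun j _ => by
              rw [abs_mul]; gcongr; exact hbd a j
          _ = (∑ j ∈ s.erase k, |φ (σ k) (w j)|) * ‖a‖ := by rw [← Finset.mul_sum, mul_comm]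
          _ ≤ η / 2 * ‖a‖ := by
              gcongr
              exact hσs k (s.erase k) (Finset.notMem_erase k s)
      have h3 : |φ (σ k) (∑ j ∈ s, a j • w j)| ≤ ‖∑ j ∈ s, a j • w j‖ := by
        have := (φ (σ k)).le_opNorm (∑ j ∈ s, a j • w j)
        rwa [hφ1, one_mul] at this
      have h4 : η * |a k| ≤ |a k * ‖w k‖| := by
        rw [abs_mul, abs_norm, mul_comm]
        gcongr
        exact hv (σ k)
      have h5 := abs_sub_abs_le_abs_sub (a k * ‖w k‖) (-∑ j ∈ s.erase k, a j * φ (σ k) (w j))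
      rw [abs_neg, sub_neg_eq_add, ← h1] at h5
      linarith
    have hle : ‖a‖ ≤ (‖J a‖ + η / 2 * ‖a‖) / η := by
      rw [← ZeroAtInftyContinuousMap.norm_toBCF_eq_norm,
        BoundedContinuousFunction.norm_le (by positivity)]
      intro k
      rw [ZeroAtInftyContinuousMap.norm_toBCF_eq_norm, le_div_iff₀' hη]
      have := hk k
      change η * |a k| ≤ _
      linarith
    rw [le_div_iff₀' hη] at hle
    linarith

end CZero

/-! ### Vector multiples of indicators of clopen sets. -/

section ClopenIndicator

variable {K E : Type*} [TopologicalSpace K] [NormedAddCommGroup E]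

open Classical in
/-- The continuous function equal to `e` on the clopen set `V` and to `0` elsewhere. -/
def clopenIndicator {V : Set K} (hV : IsClopen V) (e : E) : C(K, E) :=
  ⟨V.indicator fun _ => e, continuous_const.indicator fun x hx => by
    rw [hV.frontier_eq] at hx; exact absurd hx (notMem_empty x)⟩

theorem clopenIndicator_of_mem {V : Set K} (hV : IsClopen V) (e : E) {x : K} (hx : x ∈ V) :
    clopenIndicator hV e x = e := indicator_of_mem hx fun _ => e

theorem clopenIndicator_of_notMem {V : Set K} (hV : IsClopen V) (e : E) {x : K} (hx : x ∉ V) :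
    clopenIndicator hV e x = 0 := indicator_of_notMem hx fun _ => e

theorem norm_sum_clopenIndicator_le [CompactSpace K] {ι : Type*} {V : ι → Set K}
    (hV : ∀ i, IsClopen (V i)) (hd : Pairwise (Function.onFun Disjoint V)) (s : Finset ι)
    (z : ι → E) {M : ℝ} (hM : 0 ≤ M) (hz : ∀ i ∈ s, ‖z i‖ ≤ M) :
    ‖∑ i ∈ s, clopenIndicator (hV i) (z i)‖ ≤ M := by
  rw [ContinuousMap.norm_le _ hM]
  intro x
  rw [ContinuousMap.sum_apply]
  by_cases h : ∃ i ∈ s, x ∈ V i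
  · obtain ⟨i, hi, hx⟩ := h
    rw [Finset.sum_eq_single_of_mem i hi fun j _ hji => clopenIndicator_of_notMem _ _ fun hxj =>
      disjoint_left.1 (hd hji) hxj hx, clopenIndicator_of_mem _ _ hx]
    exact hz i hi
  · push Not at h
    rw [Finset.sum_eq_zero fun i hi => clopenIndicator_of_notMem _ _ (h i hi), norm_zero]
    exact hM

theorem clopenIndicator_add {V : Set K} (hV : IsClopen V) (e e' : E) :
    clopenIndicator hV (e + e') = clopenIndicator hV e + clopenIndicator hV e' := by
  ext x
  by_cases hx : x ∈ V <;> simp [clopenIndicator, hx]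

theorem clopenIndicator_smul [NormedSpace ℝ E] {V : Set K} (hV : IsClopen V) (r : ℝ) (e : E) :
    clopenIndicator hV (r • e) = r • clopenIndicator hV e := by
  ext x
  by_cases hx : x ∈ V <;> simp [clopenIndicator, hx]

end ClopenIndicator

/-! ### Distortion below 3 and cardinalities of derived sets. -/

section Distortion

variable {K L E F : Type*} [TopologicalSpace K] [CompactSpace K] [T2Space K] [Countable K]
  [TopologicalSpace L] [CompactSpace L]
  [NormedAddCommGroup E] [NormedSpace ℝ E]
  [NormedAddCommGroup F] [NormedSpace ℝ F]

/-- Among infinitely many disjoint candidates `V n`, failure would by pigeonhole make one point of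
`T` bad for infinitely many. The values there form a weakly unconditionally Cauchy series bounded
away from zero, giving c₀ in `F`. -/
theorem exists_clopenIndicator_small_on_finite [CompleteSpace F] (hF : ¬ ContainsCZero F)
    (S : C(K, E) →ₗ[ℝ] C(L, F)) {c : ℝ} (hc : 0 ≤ c) (hS : ∀ f, ‖S f‖ ≤ c * ‖f‖)
    {α β : Ordinal.{0}} (h : β < α) {x : K} (hx : x ∈ iteratedDerivedSet K α) {U : Set K}
    (hU : IsClopen U) (hxU : x ∈ U) (e : E) {T : Set L} (hT : T.Finite) {δ : ℝ} (hδ : 0 < δ) :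
    ∃ V ⊆ U, ∃ hV : IsClopen V, (V ∩ iteratedDerivedSet K β).Nonempty ∧
      ∀ y ∈ T, ‖S (clopenIndicator hV e) y‖ < δ := by
  obtain ⟨V, hV, hd⟩ := exists_seq_isClopen_disjoint h hx hU hxU
  by_contra! hcon
  have hcon' := fun n => hcon (V n) (hV n).1 (hV n).2.1 (hV n).2.2
  choose y hyT hy using hcon'
  have : Finite T := hT
  obtain ⟨y₀, hy₀⟩ := Finite.exists_infinite_fiber fun n => (⟨y n, hyT n⟩ : T)
  let σ : ℕ ↪ ℕ := (Infinite.natEmbedding _).trans (Function.Embedding.subtype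
    (· ∈ (fun n => (⟨y n, hyT n⟩ : T)) ⁻¹' {y₀}))
  have hσ : ∀ n, y (σ n) = y₀ := fun n =>
    congrArg Subtype.val (Infinite.natEmbedding ((fun n => (⟨y n, hyT n⟩ : T)) ⁻¹' {y₀}) n).2
  refine hF (containsCZero_of_weakly_unconditional
    (fun n => S (clopenIndicator (hV (σ n)).2.1 e) y₀) (c := c * ‖e‖) hδ ?_ fun n => ?_)
  · intro s a M hM ha
    have h1 : ∑ j ∈ s, a j • S (clopenIndicator (hV (σ j)).2.1 e) y₀ =
        S (∑ j ∈ s, clopenIndicator (hV (σ j)).2.1 (a j • e)) y₀ := by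
      simp [clopenIndicator_smul, ContinuousMap.sum_apply]
    rw [h1]
    refine ((S _).norm_coe_le_norm y₀).trans ((hS _).trans ?_)
    rw [mul_assoc]
    refine mul_le_mul_of_nonneg_left ?_ hc
    refine norm_sum_clopenIndicator_le (fun j => (hV (σ j)).2.1)
      (fun i j hij => hd (σ.injective.ne hij)) s _ (by positivity) fun j hj => ?_
    rw [norm_smul, mul_comm]
    gcongr
    exact ha j hj
  · have := hy (σ n)
    rwa [hσ] at this

variable [T2Space L]

/-- Every point of a closed set of rank below `α` is one at which the image of the indicator of
some member of a family of nested clopen sets is small, and these nested sets have a common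
nonempty core. -/
theorem exists_core_small_on_closed [CompleteSpace F] (hF : ¬ ContainsCZero F)
    (S : C(K, E) →ₗ[ℝ] C(L, F)) {c : ℝ} (hc : 0 ≤ c) (hS : ∀ f, ‖S f‖ ≤ c * ‖f‖) (e : E)
    {δ : ℝ} (hδ : 0 < δ) (α : Ordinal.{0}) {x : K} (hx : x ∈ iteratedDerivedSet K α) {U : Set K}
    (hU : IsClopen U) (hxU : x ∈ U) {G : Set L} (hG : IsClosed G)
    (hGα : G ∩ iteratedDerivedSet L α = ∅) :
    ∃ W ⊆ U, IsClopen W ∧ W.Nonempty ∧ ∀ y ∈ G, ∃ V ⊆ U, W ⊆ V ∧ ∃ hV : IsClopen V,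
      ‖S (clopenIndicator hV e) y‖ < δ := by
  induction α using WellFoundedLT.induction generalizing x U G with
  | ind α ih =>
    rcases G.eq_empty_or_nonempty with rfl | hne
    · exact ⟨U, subset_rfl, hU, ⟨x, hxU⟩, fun y hy => absurd hy (notMem_empty y)⟩
    obtain ⟨β, hβ, -, hfin⟩ := exists_finite_inter_iteratedDerivedSet hG hne hGα
    obtain ⟨V, hVU, hV, ⟨z, hzV, hz⟩, hsmall⟩ :=
      exists_clopenIndicator_small_on_finite hF S hc hS hβ hx hU hxU e hfin hδ
    have hG' : IsClosed (G ∩ {y | δ ≤ ‖S (clopenIndicator hV e) y‖}) :=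
      hG.inter (isClosed_le continuous_const (map_continuous _).norm)
    -- Since `V` is small on the finite set where `G` meets the `β`-th derived set, the part of `G`
    -- where `V` fails misses that derived set. The induction continues there, inside `V`.
    obtain ⟨W, hWV, hW, hWne, hWs⟩ := ih β hβ hz hV hzV hG' (by
      rw [← subset_empty_iff]
      rintro y ⟨⟨hyG, hyδ⟩, hyβ⟩
      exact absurd (hsmall y ⟨hyG, hyβ⟩) (not_lt.2 hyδ))
    refine ⟨W, hWV.trans hVU, hW, hWne, fun y hy => ?_⟩
    by_cases hyδ : δ ≤ ‖S (clopenIndicator hV e) y‖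
    · obtain ⟨V', hV'V, hWV', hV', hsm⟩ := hWs y ⟨hy, hyδ⟩
      exact ⟨V', hV'V.trans hVU, hWV', hV', hsm⟩
    · exact ⟨V, hVU, hWV, hV, not_le.1 hyδ⟩

/-- If `S` has distortion less than `3`, the image of a function attaining its norm near a point of
the `α`-th derived set is large somewhere on the `α`-th derived set. -/
theorem exists_mem_iteratedDerivedSet_le_norm [CompleteSpace F] (hF : ¬ ContainsCZero F)
    (S : C(K, E) →ₗ[ℝ] C(L, F)) {c : ℝ} (hc : 0 ≤ c) (hc3 : c < 3)
    (hS : ∀ f, ‖S f‖ ≤ c * ‖f‖) (hS' : ∀ f, ‖f‖ ≤ ‖S f‖) {e : E} (he : e ≠ 0)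
    {α : Ordinal.{0}} {x : K} (hx : x ∈ iteratedDerivedSet K α) {U : Set K} (hU : IsClopen U)
    (hxU : x ∈ U) {f : C(K, E)} (hf : ‖f‖ ≤ ‖e‖) (hfe : ∀ z ∈ U, f z = e) :
    ∃ y ∈ iteratedDerivedSet L α, (3 - c) / 3 * ‖e‖ ≤ ‖S f y‖ := by
  have hr : 0 < ‖e‖ := norm_pos_iff.2 he
  by_contra! hcon
  -- With this `δ`, `c * ‖e‖ + 2 * δ = (2 + c / 3) * ‖e‖`, which is below `3 * ‖e‖` exactly because
  -- `c < 3`.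
  set δ := (3 - c) / 3 * ‖e‖ with hδdef
  have hδ : 0 < δ := mul_pos (by linarith) hr
  obtain ⟨W, hWU, hW, ⟨w, hw⟩, hWs⟩ := exists_core_small_on_closed hF S hc hS e hδ α hx hU hxU
    (G := {y | δ ≤ ‖S f y‖}) (isClosed_le continuous_const (map_continuous _).norm) (by
      rw [← subset_empty_iff]
      rintro y ⟨hy, hyα⟩
      exact absurd (hcon y hyα) (not_lt.2 hy))
  have hbound : ∀ (g : C(K, E)), ‖g‖ ≤ ‖e‖ → ∀ y, ‖S g y‖ ≤ c * ‖e‖ := fun g hg y =>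
    ((S g).norm_coe_le_norm y).trans ((hS g).trans (by gcongr))
  have hfz : ∀ z, ‖f z‖ ≤ ‖e‖ := fun z => (f.norm_coe_le_norm z).trans hf
  have hminus : ‖f - (2 : ℝ) • clopenIndicator hW e‖ ≤ ‖e‖ := by
    rw [ContinuousMap.norm_le _ hr.le]
    intro z
    by_cases hz : z ∈ W
    · have : e - (2 : ℝ) • e = -e := by rw [two_smul]; abel
      simp [clopenIndicator_of_mem, hz, hfe z (hWU hz), this]
    · simpa [clopenIndicator_of_notMem, hz] using hfz z
  have hpm : ∀ V ⊆ U, W ⊆ V → ∀ hV : IsClopen V,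
      ‖f - (2 : ℝ) • clopenIndicator hV e + (2 : ℝ) • clopenIndicator hW e‖ ≤ ‖e‖ := by
    intro V hVU hWV hV
    rw [ContinuousMap.norm_le _ hr.le]
    intro z
    by_cases hz : z ∈ W
    · simp [clopenIndicator_of_mem, hz, hWV hz, hfe z (hWU hz)]
    · by_cases hzV : z ∈ V
      · have : e - (2 : ℝ) • e = -e := by rw [two_smul]; abel
        simp [clopenIndicator_of_notMem, clopenIndicator_of_mem, hz, hzV, hfe z (hVU hzV), this]
      · simpa [clopenIndicator_of_notMem, hz, hzV] using hfz z
  have hbig : 3 * ‖e‖ ≤ ‖f + (2 : ℝ) • clopenIndicator hW e‖ := by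
    have h1 : (f + (2 : ℝ) • clopenIndicator hW e) w = (3 : ℝ) • e := by
      have : (3 : ℝ) • e = e + (2 : ℝ) • e := by
        rw [show (3 : ℝ) = 1 + 2 by norm_num, add_smul, one_smul]
      simp [clopenIndicator_of_mem, hw, hfe w (hWU hw), this]
    have h2 := (f + (2 : ℝ) • clopenIndicator hW e).norm_coe_le_norm w
    rw [h1, norm_smul] at h2
    simpa using h2
  have hsmall : ‖S (f + (2 : ℝ) • clopenIndicator hW e)‖ ≤ c * ‖e‖ + 2 * δ := by
    rw [ContinuousMap.norm_le _ (by positivity)]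
    intro y
    -- Where `S f` is large, write f + 2·1_W e = (f - 2·1_V e + 2·1_W e) + 2·1_V e; elsewhere, write
    -- it as -(f - 2·1_W e) + 2f. Either way the first summand has norm at most `‖e‖` and the
    -- doubled one has a small image at `y`.
    have hkey : ∀ (p q : F) (g : C(K, E)), ‖g‖ ≤ ‖e‖ → ‖q‖ ≤ δ →
        (p = S g y + (2 : ℝ) • q ∨ p = -S g y + (2 : ℝ) • q) → ‖p‖ ≤ c * ‖e‖ + 2 * δ := by
      intro p q g hg hq hp
      have h1 := hbound g hg y
      have h2 : ‖(2 : ℝ) • q‖ ≤ 2 * δ := by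
        rw [norm_smul, Real.norm_ofNat]; gcongr
      rcases hp with rfl | rfl
      · exact (norm_add_le _ _).trans (add_le_add h1 h2)
      · exact (norm_add_le _ _).trans (add_le_add (by rwa [norm_neg]) h2)
    by_cases hy : δ ≤ ‖S f y‖
    · obtain ⟨V, hVU, hWV, hV, hsm⟩ := hWs y hy
      refine hkey _ _ _ (hpm V hVU hWV hV) hsm.le (Or.inl ?_)
      simp only [map_add, map_sub, map_smul, ContinuousMap.add_apply, ContinuousMap.sub_apply,
        ContinuousMap.smul_apply]
      abel
    · refine hkey _ _ _ hminus (not_le.1 hy).le (Or.inr ?_)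
      simp only [map_add, map_sub, two_smul, ContinuousMap.add_apply, ContinuousMap.sub_apply]
      abel
  have := hbig.trans ((hS' _).trans hsmall)
  rw [hδdef] at this
  nlinarith

/-- Given more points in K^(α) than the m points of L^(α), spread m + 1 vectors over disjoint clopen
neighbourhoods, apply `S` and evaluate on L^(α). The lower bound on S f makes this an embedding of
E^(m+1) into F^m. -/
theorem ncard_iteratedDerivedSet_le [CompleteSpace F] [Nontrivial E] (hF : ¬ ContainsCZero F)
    (S : C(K, E) →ₗ[ℝ] C(L, F)) {c : ℝ} (hc : 0 ≤ c) (hc3 : c < 3)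
    (hS : ∀ f, ‖S f‖ ≤ c * ‖f‖) (hS' : ∀ f, ‖f‖ ≤ ‖S f‖)
    (hpow : ∀ m n : ℕ, 1 ≤ m → m < n → ¬ ContainsIsomorphicCopy (Fin m → F) (Fin n → E))
    {α : Ordinal.{0}} (hfin : (iteratedDerivedSet L α).Finite) :
    (iteratedDerivedSet K α).Finite ∧
      (iteratedDerivedSet K α).ncard ≤ (iteratedDerivedSet L α).ncard := by
  -- The case m = 0 is outside `hpow`; there a constant function already produces a point of L^(α).
  rcases (iteratedDerivedSet L α).eq_empty_or_nonempty with hempty | hne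
  · have : iteratedDerivedSet K α = ∅ := by
      by_contra hcon
      obtain ⟨x, hx⟩ := nonempty_iff_ne_empty.2 hcon
      obtain ⟨e, he⟩ := exists_ne (0 : E)
      obtain ⟨y, hy, -⟩ := exists_mem_iteratedDerivedSet_le_norm hF S hc hc3 hS hS' he hx
        isClopen_univ (mem_univ x) (f := ContinuousMap.const K e)
        ((ContinuousMap.norm_le _ (norm_nonneg e)).2 fun _ => le_rfl) fun _ _ => rfl
      rw [hempty] at hy
      exact hy
    simp [this]
  by_contra hcon
  set m := (iteratedDerivedSet L α).ncard with hm
  have hmpos : 1 ≤ m := (ncard_pos hfin).2 hne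
  obtain ⟨t, htsub, htcard⟩ : ∃ t ⊆ iteratedDerivedSet K α, t.encard = (m + 1 : ℕ) := by
    refine exists_subset_encard_eq ?_
    by_contra hlt
    rw [not_le] at hlt
    have hKfin : (iteratedDerivedSet K α).Finite :=
      encard_lt_top_iff.1 (hlt.trans_le le_top)
    rw [← hKfin.cast_ncard_eq, Nat.cast_lt] at hlt
    exact hcon ⟨hKfin, Nat.lt_succ_iff.1 hlt⟩
  have htfin : t.Finite := finite_of_encard_eq_coe htcard
  have htn : Nat.card t = m + 1 := by
    rw [Nat.card_coe_set_eq, ncard_def, htcard]; rfl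
  have : Finite t := htfin
  have : Finite (iteratedDerivedSet L α) := hfin
  let p : Fin (m + 1) ≃ t := (Finite.equivFinOfCardEq htn).symm
  let q : Fin m ≃ iteratedDerivedSet L α := (Finite.equivFinOfCardEq hm.symm).symm
  obtain ⟨O, hO, hOd⟩ := htfin.t2_separation
  have hU : ∀ i, ∃ V : Set K, IsClopen V ∧ (p i : K) ∈ V ∧ V ⊆ O (p i) := fun i =>
    exists_isClopen_subset_of_countable (hO _).2 (hO _).1
  choose U hUc hpU hUO using hU
  have hUd : Pairwise (Function.onFun Disjoint U) := fun i j hij =>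
    (hOd (p i).2 (p j).2 fun h => hij (p.injective (Subtype.ext h))).mono (hUO i) (hUO j)
  let J : (Fin (m + 1) → E) →ₗ[ℝ] (Fin m → F) :=
    { toFun := fun z j => S (∑ i, clopenIndicator (hUc i) (z i)) (q j)
      map_add' := fun z z' => by
        funext j
        simp [clopenIndicator_add, Finset.sum_add_distrib]
      map_smul' := fun r z => by
        funext j
        simp [clopenIndicator_smul, ← Finset.smul_sum] }
  refine hpow m (m + 1) hmpos m.lt_succ_self (containsIsomorphicCopy_of_bounds J (C := c)
    (η := (3 - c) / 3) (by linarith) (fun z => ?_) fun z => ?_)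
  · refine (pi_norm_le_iff_of_nonneg (by positivity)).2 fun j => ?_
    refine ((S _).norm_coe_le_norm _).trans ((hS _).trans ?_)
    gcongr
    exact norm_sum_clopenIndicator_le hUc hUd _ z (norm_nonneg z) fun i _ => norm_le_pi_norm z i
  -- A coordinate of maximal norm serves as `e`, so that the whole function has norm at most `‖e‖`.
  · obtain ⟨i, hi⟩ : ∃ i, ‖z i‖ = ‖z‖ := by
      obtain ⟨i, -, hi⟩ := Finset.exists_max_image Finset.univ (fun i => ‖z i‖)
        ⟨0, Finset.mem_univ _⟩
      exact ⟨i, le_antisymm (norm_le_pi_norm z i)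
        ((pi_norm_le_iff_of_nonneg (norm_nonneg _)).2 fun j => hi j (Finset.mem_univ j))⟩
    by_cases hz : z i = 0
    · rw [← hi, hz, norm_zero, mul_zero]
      exact norm_nonneg _
    obtain ⟨y, hy, hle⟩ := exists_mem_iteratedDerivedSet_le_norm hF S hc hc3 hS hS' hz
      (htsub (p i).2) (hUc i) (hpU i) (f := ∑ i, clopenIndicator (hUc i) (z i))
      (norm_sum_clopenIndicator_le hUc hUd _ z (norm_nonneg _) fun j _ =>
        hi ▸ norm_le_pi_norm z j) (fun w hw => by
        rw [ContinuousMap.sum_apply, Finset.sum_eq_single_of_mem i (Finset.mem_univ i)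
          fun j _ hji => clopenIndicator_of_notMem _ _ fun hwj =>
            disjoint_left.1 (hUd hji) hwj hw, clopenIndicator_of_mem _ _ hw])
    rw [← hi]
    refine hle.trans ?_
    have := norm_le_pi_norm (J z) (q.symm ⟨y, hy⟩)
    simpa [J] using this

end Distortion

/-! ### Milman's partial converse to Krein–Milman. -/

section Milman

theorem IsCompact.convexJoin {V : Type*} [AddCommGroup V] [Module ℝ V] [TopologicalSpace V]
    [ContinuousAdd V] [ContinuousSMul ℝ V] {A B : Set V} (hA : IsCompact A) (hB : IsCompact B) :
    IsCompact (_root_.convexJoin ℝ A B) := by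
  have h : _root_.convexJoin ℝ A B =
      (fun p : ℝ × V × V => (1 - p.1) • p.2.1 + p.1 • p.2.2) '' (Icc (0 : ℝ) 1 ×ˢ A ×ˢ B) := by
    ext z
    simp only [mem_convexJoin, segment_eq_image, mem_image, mem_prod, Prod.exists]
    constructor
    · rintro ⟨a, ha, b, hb, θ, hθ, rfl⟩
      exact ⟨θ, a, b, ⟨hθ, ha, hb⟩, rfl⟩
    · rintro ⟨θ, a, b, ⟨hθ, ha, hb⟩, rfl⟩
      exact ⟨a, ha, b, hb, θ, hθ, rfl⟩
  rw [h]
  exact (isCompact_Icc.prod (hA.prod hB)).image (by fun_prop)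

/-- **Milman's theorem**: extreme points of the closed convex hull of a compact set lie in that
set, provided that the hull is compact. -/
theorem extremePoints_closure_convexHull_subset {V : Type*} [AddCommGroup V] [Module ℝ V]
    [TopologicalSpace V] [T2Space V] [IsTopologicalAddGroup V] [ContinuousSMul ℝ V]
    [LocallyConvexSpace ℝ V] {D : Set V} (hD : IsCompact D)
    (hC : IsCompact (closure (convexHull ℝ D))) :
    (closure (convexHull ℝ D)).extremePoints ℝ ⊆ D := by
  intro φ hφ
  by_contra hφD
  obtain ⟨hφC, hext⟩ := mem_extremePoints_iff_forall_segment.1 hφ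
  have hsub : ∀ s : Set V, closure (convexHull ℝ (s ∩ D)) ⊆ closure (convexHull ℝ D) := fun s =>
    closure_mono (convexHull_mono inter_subset_right)
  have key : φ ∉ closure (convexHull ℝ (D ∩ D)) := by
    -- Small pieces of `D` are separated from `φ` by a half-space. For unions, the hull lies in the
    -- join of two compact hulls, and extremality would place `φ` in one of them.
    refine hD.induction_on (p := fun s => φ ∉ closure (convexHull ℝ (s ∩ D))) (by simp)
      (fun s t hst ht h => ht (closure_mono (convexHull_mono (inter_subset_inter_left _ hst)) h))
      (fun s t hs ht h => ?_) fun d hd => ?_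
    · rw [union_inter_distrib_right] at h
      rcases (s ∩ D).eq_empty_or_nonempty with hse | hse
      · rw [hse, empty_union] at h; exact ht h
      rcases (t ∩ D).eq_empty_or_nonempty with hte | hte
      · rw [hte, union_empty] at h; exact hs h
      have hsc := hC.of_isClosed_subset isClosed_closure (hsub s)
      have htc := hC.of_isClosed_subset isClosed_closure (hsub t)
      have hscv : Convex ℝ (closure (convexHull ℝ (s ∩ D))) := (convex_convexHull ℝ _).closure
      have htcv : Convex ℝ (closure (convexHull ℝ (t ∩ D))) := (convex_convexHull ℝ _).closure
      have hsn : s ∩ D ⊆ closure (convexHull ℝ (s ∩ D)) :=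
        (subset_convexHull ℝ _).trans subset_closure
      have htn : t ∩ D ⊆ closure (convexHull ℝ (t ∩ D)) :=
        (subset_convexHull ℝ _).trans subset_closure
      have hle : closure (convexHull ℝ (s ∩ D ∪ t ∩ D)) ⊆ convexJoin ℝ
          (closure (convexHull ℝ (s ∩ D))) (closure (convexHull ℝ (t ∩ D))) :=
        closure_minimal (convexHull_min (union_subset
          (hsn.trans (subset_convexJoin_left (hte.mono htn)))
          (htn.trans (subset_convexJoin_right (hse.mono hsn))))
          (hscv.convexJoin htcv)) (hsc.convexJoin htc).isClosed
      obtain ⟨a, ha, b, hb, hab⟩ := mem_convexJoin.1 (hle h)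
      rcases hext a (hsub s ha) b (hsub t hb) hab with rfl | rfl
      · exact hs ha
      · exact ht hb
    · have hne : d ≠ φ := fun h => hφD (h ▸ hd)
      obtain ⟨l, hl⟩ := geometric_hahn_banach_point_point hne
      obtain ⟨r, hr1, hr2⟩ := exists_between hl
      refine ⟨{z | l z < r}, mem_nhdsWithin_of_mem_nhds
        ((isOpen_lt l.continuous continuous_const).mem_nhds hr1), fun h => ?_⟩
      have hle : closure (convexHull ℝ ({z | l z < r} ∩ D)) ⊆ {z | l z ≤ r} :=
        closure_minimal (convexHull_min (fun z hz => (show l z < r from hz.1).le)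
          (convex_halfSpace_le l.toLinearMap.isLinear r))
          (isClosed_le l.continuous continuous_const)
      exact absurd (hle h) (not_le.2 hr2)
  rw [inter_self] at key
  exact key hφC

end Milman

/-! ### The Choquet boundary as a norming set. -/

section ChoquetBoundary

variable {K X : Type*} [TopologicalSpace K] [CompactSpace K] [NormedAddCommGroup X]
  [NormedSpace ℝ X]

/-- The evaluation functional at `x`, as an element of the weak-* dual. -/
def weakEval (ι : X →ₗᵢ[ℝ] C(K, ℝ)) (x : K) : WeakDual ℝ X :=
  StrongDual.toWeakDual ((ContinuousMap.evalCLM ℝ x : C(K, ℝ) →L[ℝ] ℝ).comp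
    ι.toContinuousLinearMap)

theorem weakEval_apply (ι : X →ₗᵢ[ℝ] C(K, ℝ)) (x : K) (f : X) : weakEval ι x f = ι f x := rfl

theorem continuous_weakEval (ι : X →ₗᵢ[ℝ] C(K, ℝ)) : Continuous (weakEval ι) :=
  WeakDual.continuous_of_continuous_eval fun f => (ι f).continuous

instance : LocallyConvexSpace ℝ (WeakDual ℝ X) :=
  WeakBilin.locallyConvexSpace (B := topDualPairing ℝ X)

variable (X) in
/-- The dual unit ball as a subset of the weak-* dual. -/
def weakDualUnitBall : Set (WeakDual ℝ X) := {φ | ∀ f, |φ f| ≤ ‖f‖}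

theorem isCompact_weakDualUnitBall : IsCompact (weakDualUnitBall X) := by
  have h : weakDualUnitBall X =
      WeakDual.toStrongDual ⁻¹' Metric.closedBall (0 : StrongDual ℝ X) 1 := by
    ext φ
    rw [mem_preimage, mem_closedBall_zero_iff, ContinuousLinearMap.opNorm_le_iff zero_le_one]
    simp only [one_mul]
    rfl
  rw [h]
  exact WeakDual.isCompact_closedBall _ _

theorem convex_weakDualUnitBall : Convex ℝ (weakDualUnitBall X) := by
  intro φ hφ ψ hψ a b ha hb hab f
  have h1 : (a • φ + b • ψ) f = a * φ f + b * ψ f := rfl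
  rw [h1]
  calc |a * φ f + b * ψ f| ≤ |a * φ f| + |b * ψ f| := abs_add_le _ _
    _ = a * |φ f| + b * |ψ f| := by rw [abs_mul, abs_mul, abs_of_nonneg ha, abs_of_nonneg hb]
    _ ≤ a * ‖f‖ + b * ‖f‖ := by
        gcongr
        · exact hφ f
        · exact hψ f
    _ = ‖f‖ := by rw [← add_mul, hab, one_mul]

theorem neg_mem_weakDualUnitBall {φ : WeakDual ℝ X} :
    -φ ∈ weakDualUnitBall X ↔ φ ∈ weakDualUnitBall X := by
  refine forall_congr' fun f => ?_
  have : (-φ) f = -φ f := rfl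
  rw [this, abs_neg]

theorem weakEval_mem_weakDualUnitBall (ι : X →ₗᵢ[ℝ] C(K, ℝ)) (x : K) :
    weakEval ι x ∈ weakDualUnitBall X := fun f =>
  ((ι f).norm_coe_le_norm x).trans (ι.norm_map f).le

/-- Hahn–Banach: a weak-* continuous separating functional is evaluation at some `g`. A bound for
`g` at all points of `K` bounds its norm, hence every value `φ g` with `φ` in the ball. -/
theorem weakDualUnitBall_eq_closure_convexHull [Nonempty K] (ι : X →ₗᵢ[ℝ] C(K, ℝ)) :
    weakDualUnitBall X =
      closure (convexHull ℝ (range (weakEval ι) ∪ range fun x => -weakEval ι x)) := by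
  refine subset_antisymm (fun φ hφ => ?_) ?_
  · by_contra hcon
    obtain ⟨l, u, hlu, hu⟩ := geometric_hahn_banach_closed_point
      (convex_convexHull ℝ _).closure isClosed_closure hcon
    obtain ⟨g, hg⟩ : ∃ g : X, ∀ ψ : WeakDual ℝ X, l ψ = ψ g := by
      obtain ⟨g, hg⟩ := LinearMap.dualEmbedding_surjective (topDualPairing ℝ X) l
      exact ⟨g, fun ψ => by rw [← hg]; rfl⟩
    have hsub := (subset_convexHull ℝ (range (weakEval ι) ∪ range fun x => -weakEval ι x)).trans
      subset_closure
    have hgu : ∀ x, |ι g x| < u := by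
      intro x
      have h1 := hlu _ (hsub (Or.inl ⟨x, rfl⟩))
      have h2 := hlu _ (hsub (Or.inr ⟨x, rfl⟩))
      simp only [map_neg] at h2
      rw [hg, weakEval_apply] at h1 h2
      exact abs_lt.2 ⟨by linarith, h1⟩
    have hnorm : ‖ι g‖ ≤ u := (ContinuousMap.norm_le_of_nonempty _).2 fun x => (hgu x).le
    rw [ι.norm_map] at hnorm
    have := (le_abs_self _).trans (hφ g)
    rw [hg] at hu
    linarith
  · refine closure_minimal (convexHull_min ?_ convex_weakDualUnitBall)
      isCompact_weakDualUnitBall.isClosed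
    rintro φ (⟨x, rfl⟩ | ⟨x, rfl⟩)
    · exact weakEval_mem_weakDualUnitBall ι x
    · exact neg_mem_weakDualUnitBall.2 (weakEval_mem_weakDualUnitBall ι x)

theorem extremePoints_weakDualUnitBall_subset [Nonempty K] (ι : X →ₗᵢ[ℝ] C(K, ℝ)) :
    (weakDualUnitBall X).extremePoints ℝ ⊆
      range (weakEval ι) ∪ range fun x => -weakEval ι x := by
  rw [weakDualUnitBall_eq_closure_convexHull ι]
  refine extremePoints_closure_convexHull_subset
    ((isCompact_range (continuous_weakEval ι)).union
      (isCompact_range (continuous_weakEval ι).neg)) ?_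
  rw [← weakDualUnitBall_eq_closure_convexHull]
  exact isCompact_weakDualUnitBall

/-- Every element of a function space attains its norm at a point whose evaluation functional is an
extreme point of the dual unit ball. -/
theorem exists_weakEval_mem_extremePoints [Nonempty K] (ι : X →ₗᵢ[ℝ] C(K, ℝ)) (g : X) :
    ∃ x, weakEval ι x ∈ (weakDualUnitBall X).extremePoints ℝ ∧ |ι g x| = ‖g‖ := by
  -- `P` is a nonempty compact face, so by Krein–Milman it has an extreme point, also extreme in the
  -- ball. By Milman it is plus or minus an evaluation, and the ball is symmetric.
  set P : Set (WeakDual ℝ X) := weakDualUnitBall X ∩ {φ | φ g = ‖g‖}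
  have hPne : P.Nonempty := by
    obtain ⟨y, -, hy⟩ := isCompact_univ.exists_isMaxOn (univ_nonempty (α := K))
      (map_continuous (ι g)).norm.continuousOn
    have hyn : ‖ι g y‖ = ‖g‖ := by
      rw [← ι.norm_map]
      exact le_antisymm ((ι g).norm_coe_le_norm y)
        ((ContinuousMap.norm_le _ (norm_nonneg _)).2 fun z => hy (mem_univ z))
    rcases le_total 0 (ι g y) with h | h
    · exact ⟨weakEval ι y, weakEval_mem_weakDualUnitBall ι y, by
        rw [← hyn, Real.norm_of_nonneg h]; rfl⟩
    · exact ⟨-weakEval ι y, neg_mem_weakDualUnitBall.2 (weakEval_mem_weakDualUnitBall ι y), by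
        rw [← hyn, Real.norm_of_nonpos h]; rfl⟩
  have hPc : IsCompact P := isCompact_weakDualUnitBall.inter_right
    (isClosed_eq (WeakDual.eval_continuous g) continuous_const)
  obtain ⟨φ, hφ⟩ := hPc.extremePoints_nonempty hPne
  have hextr : IsExtreme ℝ (weakDualUnitBall X) P := by
    refine ⟨inter_subset_left, fun ψ hψ χ hχ ω hω hseg => ⟨hψ, ?_⟩⟩
    obtain ⟨a, b, ha, hb, hab, rfl⟩ := hseg
    have h1 : a * ψ g + b * χ g = ‖g‖ := hω.2
    have h2 : ψ g ≤ ‖g‖ := (le_abs_self _).trans (hψ g)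
    have h3 : χ g ≤ ‖g‖ := (le_abs_self _).trans (hχ g)
    refine le_antisymm h2 ?_
    have h4 : b * χ g ≤ b * ‖g‖ := by gcongr
    have h5 : a * ‖g‖ + b * ‖g‖ = ‖g‖ := by rw [← add_mul, hab, one_mul]
    exact le_of_mul_le_mul_left (by linarith) ha
  have hφB : φ ∈ (weakDualUnitBall X).extremePoints ℝ :=
    hextr.extremePoints_subset_extremePoints hφ
  have hφg : φ g = ‖g‖ := (extremePoints_subset hφ).2
  rcases extremePoints_weakDualUnitBall_subset ι hφB with ⟨x, rfl⟩ | ⟨x, rfl⟩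
  · refine ⟨x, hφB, ?_⟩
    have : ι g x = ‖g‖ := hφg
    rw [this, abs_norm]
  · refine ⟨x, ?_, ?_⟩
    · rw [mem_extremePoints_iff_left] at hφB ⊢
      refine ⟨weakEval_mem_weakDualUnitBall ι x, fun ψ hψ χ hχ hseg => ?_⟩
      have := hφB.2 (-ψ) (neg_mem_weakDualUnitBall.2 hψ) (-χ) (neg_mem_weakDualUnitBall.2 hχ) (by
        obtain ⟨a, b, ha, hb, hab, h⟩ := hseg
        exact ⟨a, b, ha, hb, hab, by
          change _ = -weakEval ι x
          rw [← h, smul_neg, smul_neg, neg_add]⟩)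
      exact neg_injective this
    · have : -ι g x = ‖g‖ := hφg
      rw [← abs_neg, this, abs_norm]

/-- Extremality is purely algebraic, so it passes from the weak-* dual, where compactness is
available, to the dual used in `choquetBoundary`. -/
theorem evalFunctional_mem_extremePoints {A : Submodule ℝ C(K, ℝ)} {x : K}
    (h : weakEval A.subtypeₗᵢ x ∈ (weakDualUnitBall A).extremePoints ℝ) :
    evalFunctional A x ∈ (dualUnitBall A).extremePoints ℝ := by
  rw [mem_extremePoints_iff_left] at h ⊢
  have hbound : ∀ φ ∈ dualUnitBall A, ∀ f : A, ‖φ.toLinearMap f‖ ≤ 1 * ‖f‖ := fun φ hφ f => by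
    rw [one_mul]; exact hφ f
  refine ⟨fun f => (f : C(K, ℝ)).norm_coe_le_norm x, fun φ hφ ψ hψ hseg => ?_⟩
  have key := h.2 (StrongDual.toWeakDual (φ.toLinearMap.mkContinuous 1 (hbound φ hφ))) hφ
    (StrongDual.toWeakDual (ψ.toLinearMap.mkContinuous 1 (hbound ψ hψ))) hψ (by
      obtain ⟨a, b, ha, hb, hab, h⟩ := hseg
      refine ⟨a, b, ha, hb, hab, ?_⟩
      exact DFunLike.ext _ _ fun f => DFunLike.congr_fun h f)
  ext f
  exact DFunLike.congr_fun key f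

variable {E : Type*} [NormedAddCommGroup E] [NormedSpace ℝ E]

/-- Functions in the scalar space of `H` attain their norm on the Choquet boundary. -/
theorem exists_mem_choquetBoundary_abs_eq_norm [Nonempty K] (H : Submodule ℝ C(K, E))
    {g : C(K, ℝ)} (hg : g ∈ scalarSpace H) : ∃ x ∈ choquetBoundary H, |g x| = ‖g‖ := by
  obtain ⟨x, hx, hxg⟩ :=
    exists_weakEval_mem_extremePoints (X := scalarSpace H) (scalarSpace H).subtypeₗᵢ ⟨g, hg⟩
  exact ⟨x, evalFunctional_mem_extremePoints hx, hxg⟩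

/-- Composing `h` with a functional norming `h y` gives a member of the scalar space, which attains
its norm on the boundary. -/
theorem norm_le_of_forall_mem_choquetBoundary (H : Submodule ℝ C(K, E)) {h : C(K, E)}
    (hh : h ∈ H) {M : ℝ} (hM : 0 ≤ M) (hle : ∀ x ∈ choquetBoundary H, ‖h x‖ ≤ M) : ‖h‖ ≤ M := by
  rw [ContinuousMap.norm_le _ hM]
  intro y
  have : Nonempty K := ⟨y⟩
  obtain ⟨φ, hφ1, hφ⟩ := exists_dual_vector'' ℝ (h y)
  have hmem : dualComp φ h ∈ scalarSpace H :=
    Submodule.le_topologicalClosure _ (Submodule.subset_span ⟨φ, h, hh, rfl⟩)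
  obtain ⟨x, hx, hxn⟩ := exists_mem_choquetBoundary_abs_eq_norm H hmem
  calc ‖h y‖ = φ (h y) := hφ.symm
    _ ≤ ‖dualComp φ h‖ := (le_abs_self _).trans ((dualComp φ h).norm_coe_le_norm y)
    _ = |φ (h x)| := hxn.symm
    _ ≤ ‖φ‖ * ‖h x‖ := φ.le_opNorm _
    _ ≤ 1 * ‖h x‖ := by gcongr
    _ ≤ M := by rw [one_mul]; exact hle x hx

end ChoquetBoundary

/-! ### Restriction to the boundary is onto. -/

section Restriction

variable {K E : Type*} [TopologicalSpace K] [CompactSpace K] [NormedAddCommGroup E]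
  [NormedSpace ℝ E]

/-- Restriction of the functions in `H` to its closed Choquet boundary is isometric. -/
def restrictChoquet (H : Submodule ℝ C(K, E)) [CompactSpace (choquetBoundary H)] :
    H →ₗᵢ[ℝ] C(choquetBoundary H, E) where
  toFun h := (h : C(K, E)).restrict (choquetBoundary H)
  map_add' _ _ := rfl
  map_smul' _ _ := rfl
  norm_map' h := by
    refine le_antisymm ?_ ?_
    · exact (ContinuousMap.norm_le _ (norm_nonneg _)).2 fun x =>
        (h : C(K, E)).norm_coe_le_norm (x : K)
    · exact norm_le_of_forall_mem_choquetBoundary H h.2 (norm_nonneg _) fun x hx =>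
        ((h : C(K, E)).restrict (choquetBoundary H)).norm_coe_le_norm ⟨x, hx⟩

/-- If each point of a compact set has a clopen neighbourhood `U` such that all functions supported
in `U` belong to `M`, then so does the whole compact set. -/
theorem exists_isClopen_forall_supported_mem {L : Type*} [TopologicalSpace L]
    (M : Submodule ℝ C(L, E)) {S : Set L} (hS : IsCompact S)
    (h : ∀ x ∈ S, ∃ U : Set L, IsClopen U ∧ x ∈ U ∧ ∀ g : C(L, E), (∀ y ∉ U, g y = 0) → g ∈ M) :
    ∃ U : Set L, IsClopen U ∧ S ⊆ U ∧ ∀ g : C(L, E), (∀ y ∉ U, g y = 0) → g ∈ M := by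
  refine hS.induction_on ?_ ?_ ?_ ?_
  · refine ⟨∅, isClopen_empty, subset_rfl, fun g hg => ?_⟩
    have : g = 0 := ContinuousMap.ext fun y => hg y (notMem_empty y)
    rw [this]; exact M.zero_mem
  · rintro s t hst ⟨U, hU, htU, hg⟩
    exact ⟨U, hU, hst.trans htU, hg⟩
  · rintro s t ⟨U, hU, hsU, hg⟩ ⟨V, hV, htV, hg'⟩
    refine ⟨U ∪ V, hU.union hV, union_subset_union hsU htV, fun g hgs => ?_⟩
    rw [← sub_add_cancel g (clopenIndicator hU (1 : ℝ) • g)]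
    refine M.add_mem (hg' _ fun y hy => ?_) (hg _ fun y hy => ?_)
    · by_cases hyU : y ∈ U
      · simp [clopenIndicator_of_mem, hyU]
      · simp [clopenIndicator_of_notMem, hyU, hgs y fun h => h.elim hyU hy]
    · simp [clopenIndicator_of_notMem, hy]
  · intro x hx
    obtain ⟨U, hU, hxU, hg⟩ := h x hx
    exact ⟨U, mem_nhdsWithin_of_mem_nhds (hU.isOpen.mem_nhds hxU), U, hU, subset_rfl, hg⟩

/-- If the Choquet boundary is closed, countable and consists of weak peak points, then every
continuous function on it extends to an element of `H`. -/
theorem restrictChoquet_surjective [T2Space K] [CompleteSpace E] (H : Submodule ℝ C(K, E))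
    (hH : IsClosed (H : Set C(K, E))) [CompactSpace (choquetBoundary H)]
    (hcount : (choquetBoundary H).Countable)
    (hpeak : ∀ x ∈ choquetBoundary H, IsWeakPeakPoint H x) :
    Function.Surjective (restrictChoquet H) := by
  have : Countable (choquetBoundary H) := hcount
  have : CompleteSpace H := hH.completeSpace_coe
  set M : Submodule ℝ C(choquetBoundary H, E) := LinearMap.range (restrictChoquet H).toLinearMap
  have hMc : IsClosed (M : Set C(choquetBoundary H, E)) := by
    have := (restrictChoquet H).isometry.isClosedEmbedding.isClosed_range
    exact this
  let good : Set (choquetBoundary H) → Prop := fun U =>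
    ∀ g : C(choquetBoundary H, E), (∀ y ∉ U, g y = 0) → g ∈ M
  -- The closed set of bad points, if nonempty, has an isolated point `x`. The weak peak property at
  -- `x` then shows that a clopen `U` with `U ∩ B = {x}` is good, a contradiction.
  set B : Set (choquetBoundary H) := {x | ¬ ∃ U, IsClopen U ∧ x ∈ U ∧ good U}
  have hBempty : B = ∅ := by
    by_contra hne
    have hBc : IsClosed B := by
      rw [← isOpen_compl_iff, isOpen_iff_mem_nhds]
      intro x hx
      obtain ⟨U, hU, hxU, hg⟩ := not_not.1 hx
      exact mem_of_superset (hU.isOpen.mem_nhds hxU) fun y hy => not_not.2 ⟨U, hU, hy, hg⟩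
    obtain ⟨x, U, hU, hxU, hUB⟩ :=
      exists_isolated_of_countable hBc (nonempty_iff_ne_empty.2 hne)
    have hxB : x ∈ U ∩ B := by rw [hUB]; rfl
    refine hxB.2 ⟨U, hU, hxU, fun g hg => ?_⟩
    change g ∈ (M : Set C(choquetBoundary H, E))
    rw [← hMc.closure_eq, Metric.mem_closure_iff]
    intro ε hε
    set e := g x with he
    obtain ⟨δ, hδ0, hδ⟩ := exists_between (lt_min (half_pos one_pos)
      (show 0 < ε / (1 + ‖e‖) by positivity))
    have hδ1 : δ < 1 := by linarith [hδ.trans_le (min_le_left _ _)]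
    have hδε : δ + δ * ‖e‖ < ε := by
      have := hδ.trans_le (min_le_right _ _)
      rw [lt_div_iff₀ (by positivity)] at this
      linarith
    obtain ⟨U', hU', hU'U⟩ := (mem_nhds_subtype _ _ _).1 (hU.isOpen.mem_nhds hxU)
    obtain ⟨h, -, hten, h01, hhx, hoff⟩ := hpeak x x.2 U' hU' δ hδ0 hδ1
    obtain ⟨V, hV, hxV, hVsub⟩ := exists_isClopen_subset_of_countable
      (U := U ∩ {y : choquetBoundary H | 1 - δ < h y ∧ ‖g y - e‖ < δ})
      (hU.isOpen.inter ((isOpen_lt continuous_const (h.continuous.comp continuous_subtype_val)).inter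
        (isOpen_lt (g.continuous.sub continuous_const).norm continuous_const)))
      ⟨hxU, hhx, by simpa [he] using hδ0⟩
    -- `U \ V` avoids `B`, so functions supported there lie in `M`. The peak function times `e`
    -- approximates `g` on `V` and off `U`; `r` corrects the error on `U \ V`.
    obtain ⟨W, hW, hUVW, hWg⟩ := exists_isClopen_forall_supported_mem M
      (hU.diff hV).isClosed.isCompact (fun y hy => by
        have hyB : y ∉ B := fun hyB => by
          have : y ∈ U ∩ B := ⟨hy.1, hyB⟩
          rw [hUB, mem_singleton_iff] at this
          exact hy.2 (this ▸ hxV)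
        exact not_not.1 hyB)
    let p : C(choquetBoundary H, E) := restrictChoquet H ⟨tensorVec h e, hten e⟩
    have hp : ∀ y, p y = h y • e := fun y => rfl
    let r : C(choquetBoundary H, E) := clopenIndicator (hU.diff hV) (1 : ℝ) • (g - p)
    have hr : r ∈ M := hWg _ fun y hy => by
      simp [r, clopenIndicator_of_notMem _ _ fun hy' => hy (hUVW hy')]
    refine ⟨p + r, M.add_mem ⟨_, rfl⟩ hr, ?_⟩
    rw [dist_eq_norm]
    refine lt_of_le_of_lt ?_ hδε
    rw [ContinuousMap.norm_le _ (by positivity)]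
    intro y
    by_cases hyUV : y ∈ U \ V
    · have : (g - (p + r)) y = 0 := by
        simp [r, clopenIndicator_of_mem _ _ hyUV]
      rw [this, norm_zero]
      positivity
    have hval : (g - (p + r)) y = g y - h y • e := by
      simp [r, clopenIndicator_of_notMem _ _ hyUV, hp]
    rw [hval]
    by_cases hyU : y ∈ U
    · have hyV : y ∈ V := by_contra fun h => hyUV ⟨hyU, h⟩
      obtain ⟨-, hy1, hy2⟩ := hVsub hyV
      have hsplit : g y - h y • e = (g y - e) + (1 - h y) • e := by
        rw [sub_smul, one_smul]; abel
      rw [hsplit]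
      refine (norm_add_le _ _).trans (add_le_add hy2.le ?_)
      rw [norm_smul, Real.norm_of_nonneg (by linarith [(h01 y).2])]
      gcongr
      linarith
    · rw [hg y hyU, zero_sub, norm_neg, norm_smul, Real.norm_of_nonneg (h01 y).1]
      have := hoff y ⟨y.2, fun hy => hyU (hU'U hy)⟩
      have : h y * ‖e‖ ≤ δ * ‖e‖ := by gcongr
      linarith
  intro g
  obtain ⟨U, -, hU, hg⟩ := exists_isClopen_forall_supported_mem M isCompact_univ (fun x _ => by
    have : x ∉ B := by rw [hBempty]; exact notMem_empty x
    exact not_not.1 this)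
  exact hg g fun y hy => absurd (hU (mem_univ y)) hy

end Restriction

/-! ### From equal derived-set counts to a homeomorphism. -/

section Homeomorphism

/-- A linear isomorphism of distortion less than `3` between spaces of continuous functions on
countable compact spaces, with values in Banach spaces that contain no copy of `c₀` and whose
powers are suitably incomparable, forces the compact spaces to be homeomorphic. -/
theorem nonempty_homeomorph_of_distortion_lt_three {K L E F : Type*}
    [TopologicalSpace K] [CompactSpace K] [T2Space K] [Countable K]
    [TopologicalSpace L] [CompactSpace L] [T2Space L] [Countable L]
    [NormedAddCommGroup E] [NormedSpace ℝ E] [CompleteSpace E] [Nontrivial E]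
    [NormedAddCommGroup F] [NormedSpace ℝ F] [CompleteSpace F] [Nontrivial F]
    (hE : ¬ ContainsCZero E) (hF : ¬ ContainsCZero F)
    (hEF : ∀ m n : ℕ, 1 ≤ m → m < n → ¬ ContainsIsomorphicCopy (Fin m → E) (Fin n → F))
    (hFE : ∀ m n : ℕ, 1 ≤ m → m < n → ¬ ContainsIsomorphicCopy (Fin m → F) (Fin n → E))
    (T : C(K, E) ≃ₗ[ℝ] C(L, F)) {a b : ℝ} (ha : 0 ≤ a) (hb : 0 ≤ b) (hab : a * b < 3)
    (hT : ∀ f, ‖T f‖ ≤ a * ‖f‖) (hT' : ∀ g, ‖T.symm g‖ ≤ b * ‖g‖) : Nonempty (K ≃ₜ L) := by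
  have hKL : ∀ α, (iteratedDerivedSet L α).Finite → (iteratedDerivedSet K α).Finite ∧
      (iteratedDerivedSet K α).ncard ≤ (iteratedDerivedSet L α).ncard := fun α =>
    -- Scaling by the bound `b` of the inverse normalises the lower bound to 1 and makes the upper
    -- bound `a * b < 3`.
    ncard_iteratedDerivedSet_le hF (b • T.toLinearMap) (mul_nonneg ha hb) hab
      (fun f => by
        have h : ‖(b • T.toLinearMap) f‖ = b * ‖T f‖ := by
          simp [norm_smul, abs_of_nonneg hb]
        rw [h, mul_comm a b, mul_assoc]
        exact mul_le_mul_of_nonneg_left (hT f) hb)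
      (fun f => by
        have h : ‖(b • T.toLinearMap) f‖ = b * ‖T f‖ := by
          simp [norm_smul, abs_of_nonneg hb]
        rw [h]
        simpa using hT' (T f)) hFE
  have hLK : ∀ α, (iteratedDerivedSet K α).Finite → (iteratedDerivedSet L α).Finite ∧
      (iteratedDerivedSet L α).ncard ≤ (iteratedDerivedSet K α).ncard := fun α =>
    ncard_iteratedDerivedSet_le hE (a • T.symm.toLinearMap) (mul_nonneg ha hb) hab
      (fun g => by
        have h : ‖(a • T.symm.toLinearMap) g‖ = a * ‖T.symm g‖ := by
          simp [norm_smul, abs_of_nonneg ha]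
        rw [h, mul_assoc]
        exact mul_le_mul_of_nonneg_left (hT' g) ha)
      (fun g => by
        have h : ‖(a • T.symm.toLinearMap) g‖ = a * ‖T.symm g‖ := by
          simp [norm_smul, abs_of_nonneg ha]
        rw [h]
        simpa using hT (T.symm g)) hEF
  rcases isEmpty_or_nonempty K with hK | hK
  · have h0 : iteratedDerivedSet K 0 = ∅ := Subsingleton.elim _ _
    obtain ⟨hfin, hle⟩ := hLK 0 (by rw [h0]; exact finite_empty)
    rw [h0, ncard_empty, Nat.le_zero, ncard_eq_zero hfin, iteratedDerivedSet_zero,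
      univ_eq_empty_iff] at hle
    exact ⟨Homeomorph.empty⟩
  · obtain ⟨γ, hγ⟩ := exists_iteratedDerivedSet_eq_empty (X := K)
    obtain ⟨β, -, hne, hfin⟩ := exists_finite_inter_iteratedDerivedSet (isClosed_univ (X := K))
      univ_nonempty (γ := γ) (by rw [hγ, inter_empty])
    obtain ⟨hfinL, hle⟩ := hLK β (by simpa using hfin)
    obtain ⟨f, hfc, hfb⟩ := matchingAtRank (X := K) (Y := L) β univ univ isClopen_univ
      isClopen_univ hne hfin (by simpa using hfinL) (by
        simpa using le_antisymm (hKL β hfinL).2 hle)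
    exact ⟨Continuous.homeoOfEquivCompactToT2
      (f := Equiv.ofBijective f (bijOn_univ.1 hfb)) (continuousOn_univ.1 hfc)⟩

end Homeomorphism

end

theorem theorem1p2
    {K₁ K₂ E₁ E₂ : Type*}
    [TopologicalSpace K₁] [CompactSpace K₁] [T2Space K₁]
    [TopologicalSpace K₂] [CompactSpace K₂] [T2Space K₂]
    [NormedAddCommGroup E₁] [NormedSpace ℝ E₁] [CompleteSpace E₁] [Nontrivial E₁]
    [NormedAddCommGroup E₂] [NormedSpace ℝ E₂] [CompleteSpace E₂] [Nontrivial E₂]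
    (hE₁ : ¬ ContainsCZero E₁) (hE₂ : ¬ ContainsCZero E₂)
    (H₁ : Submodule ℝ C(K₁, E₁)) (H₂ : Submodule ℝ C(K₂, E₂))
    (hH₁ : IsClosed (H₁ : Set C(K₁, E₁))) (hH₂ : IsClosed (H₂ : Set C(K₂, E₂)))
    (hclosed₁ : IsClosed (choquetBoundary H₁)) (hclosed₂ : IsClosed (choquetBoundary H₂))
    (hcount₁ : (choquetBoundary H₁).Countable) (hcount₂ : (choquetBoundary H₂).Countable)
    (hpeak₁ : ∀ x ∈ choquetBoundary H₁, IsWeakPeakPoint H₁ x)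
    (hpeak₂ : ∀ x ∈ choquetBoundary H₂, IsWeakPeakPoint H₂ x)
    (hpow₁ : ∀ m n : ℕ, 1 ≤ m → m < n → ¬ ContainsIsomorphicCopy (Fin m → E₁) (Fin n → E₂))
    (hpow₂ : ∀ m n : ℕ, 1 ≤ m → m < n → ¬ ContainsIsomorphicCopy (Fin m → E₂) (Fin n → E₁))
    (hT : ∃ T : H₁ ≃L[ℝ] H₂,
      ‖(T : H₁ →L[ℝ] H₂)‖ * ‖(T.symm : H₂ →L[ℝ] H₁)‖ < 3) :
    Nonempty (choquetBoundary H₁ ≃ₜ choquetBoundary H₂) := by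
  obtain ⟨T, hT⟩ := hT
  have : Countable (choquetBoundary H₁) := hcount₁
  have : Countable (choquetBoundary H₂) := hcount₂
  have : CompactSpace (choquetBoundary H₁) := isCompact_iff_compactSpace.1 hclosed₁.isCompact
  have : CompactSpace (choquetBoundary H₂) := isCompact_iff_compactSpace.1 hclosed₂.isCompact
  let R₁ : H₁ ≃ₗᵢ[ℝ] C(choquetBoundary H₁, E₁) := LinearIsometryEquiv.ofSurjective
    (restrictChoquet H₁) (restrictChoquet_surjective H₁ hH₁ hcount₁ hpeak₁)
  let R₂ : H₂ ≃ₗᵢ[ℝ] C(choquetBoundary H₂, E₂) := LinearIsometryEquiv.ofSurjective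
    (restrictChoquet H₂) (restrictChoquet_surjective H₂ hH₂ hcount₂ hpeak₂)
  refine nonempty_homeomorph_of_distortion_lt_three hE₁ hE₂ hpow₁ hpow₂
    ((R₁.symm.toLinearEquiv.trans T.toLinearEquiv).trans R₂.toLinearEquiv)
    (ContinuousLinearMap.opNorm_nonneg _) (ContinuousLinearMap.opNorm_nonneg _) hT (fun f => ?_) fun g => ?_
  · have h1 : ‖R₂ (T (R₁.symm f))‖ = ‖T (R₁.symm f)‖ := R₂.norm_map _
    have h2 := (T : H₁ →L[ℝ] H₂).le_opNorm (R₁.symm f)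
    rw [R₁.symm.norm_map] at h2
    exact h1.trans_le h2
  · have h1 : ‖R₁ (T.symm (R₂.symm g))‖ = ‖T.symm (R₂.symm g)‖ := R₁.norm_map _
    have h2 := (T.symm : H₂ →L[ℝ] H₁).le_opNorm (R₂.symm g)
    rw [R₂.symm.norm_map] at h2
    exact h1.trans_le h2
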